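/- Let $\mathbf{C}$ be a regular category, i.e. a category with finite limits and coequalizers of kernel pairs in which regular epimorphisms are stable under pullback. Let $\mathrm{Rel}(\mathbf{C})$ be the category with the same objects as $\mathbf{C}$, in which morphisms (relations) $R\colon A \nrightarrow B$ are subobjects $R \rightarrowtail A\times B$, identities are the diagonals, and $S\circ R$ is the image of the pullback $R\times_B S$ in $A\times C$, that is, $S\circ R=\{(a,c)\mid \exists b\; R(a,b)\wedge S(b,c)\}$ in the internal logic. It is a dagger monoidal category, with tensor product given by the product of $\mathbf{C}$ and $R^\dagger(b,a)\Leftrightarrow R(a,b)$. An endomorphism in a dagger category is positive if it is of the form $g^\dagger\circ g$. Suppose that $\mathbf{C}$ is positively regular: every relation $R\colon A\nrightarrow A$ in $\mathbf{C}$ that is reflexive and symmetric is positive. Let $\mathrm{CP}(\mathrm{Rel}(\mathbf{C}))$ be the category whose objects are the special dagger Frobenius structures $(A,\mu_A,\eta_A)$ in $\mathrm{Rel}(\mathbf{C})$, that is, $\mu_A\colon A\otimes A\to A$ and $\eta_A\colon I\to A$ are unital and associative with $\mu_A\circ\mu_A^\dagger=\mathrm{id}_A$ and $(\mathrm{id}_A\otimes\mu_A)\circ(\mu_A^\dagger\otimes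 \mathrm{id}_A)=(\mu_A\otimes \mathrm{id}_A)\circ(\mathrm{id}_A\otimes\mu_A^\dagger)$, and whose morphisms $A\to B$ are the morphisms $f\colon A\to B$ of $\mathrm{Rel}(\mathbf{C})$ that are completely positive: the Choi matrix $(\mathrm{id}_A\otimes\mu_B)\circ(\mathrm{id}_A\otimes f\otimes \mathrm{id}_B)\circ(\mu_A^\dagger\otimes \mathrm{id}_B)\colon A\otimes B\to A\otimes B$ is positive. Composition and identities are those of $\mathrm{Rel}(\mathbf{C})$. Then $\mathrm{CP}(\mathrm{Rel}(\mathbf{C}))$ is equivalent to the category whose objects are the internal groupoids $G=(G_0,G_1,s,t,u,m,i)$ in $\mathbf{C}$, and whose morphisms $G\to H$ are the relations $R\colon G_1\nrightarrow H_1$ in $\mathbf{C}$ that respect inverses: $$R(a,b)\ \Rightarrow\ R(a^{-1},b^{-1})\wedge R(\mathrm{id}_{\mathrm{dom}(a)},\mathrm{id}_{\mathrm{dom}(b)})$$ in the internal logic of $\mathbf{C}$, with composition and identities those of $\mathrm{Rel}(\mathbf{C})$. -/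

import Mathlib

open CategoryTheory Limits MonoidalCategory

universe v u

/-! ### Dagger monoidal categories and the CP construction -/

/-- A dagger category: an involutive, identity-on-objects contravariant functor `†`. -/
class DaggerCategory (D : Type u) [Category.{v} D] where
  /-- the dagger of a morphism -/
  dagger : ∀ {X Y : D}, (X ⟶ Y) → (Y ⟶ X)
  dagger_id : ∀ X : D, dagger (𝟙 X) = 𝟙 X
  dagger_comp : ∀ {X Y Z : D} (f : X ⟶ Y) (g : Y ⟶ Z), dagger (f ≫ g) = dagger g ≫ dagger f
  dagger_dagger : ∀ {X Y : D} (f : X ⟶ Y), dagger (dagger f) = f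

open DaggerCategory (dagger dagger_id dagger_comp dagger_dagger)

/-- A dagger monoidal category: `(f ⊗ g)† = f† ⊗ g†`, and the coherence isomorphisms are
unitary. -/
class DaggerMonoidalCategory (D : Type u) [Category.{v} D] [MonoidalCategory D]
    extends DaggerCategory D where
  dagger_tensorHom : ∀ {X Y X' Y' : D} (f : X ⟶ Y) (g : X' ⟶ Y'),
    dagger (f ⊗ₘ g) = dagger f ⊗ₘ dagger g
  dagger_associator_hom : ∀ X Y Z : D, dagger (α_ X Y Z).hom = (α_ X Y Z).inv
  dagger_leftUnitor_hom : ∀ X : D, dagger (λ_ X).hom = (λ_ X).inv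
  dagger_rightUnitor_hom : ∀ X : D, dagger (ρ_ X).hom = (ρ_ X).inv

namespace DaggerMonoidalCategory

variable {D : Type u} [Category.{v} D] [MonoidalCategory D] [DaggerMonoidalCategory D]

theorem dagger_whiskerLeft (X : D) {Y Z : D} (f : Y ⟶ Z) : dagger (X ◁ f) = X ◁ dagger f := by
  rw [← id_tensorHom, dagger_tensorHom, dagger_id, id_tensorHom]

theorem dagger_whiskerRight {Y Z : D} (f : Y ⟶ Z) (X : D) : dagger (f ▷ X) = dagger f ▷ X := by
  rw [← tensorHom_id, dagger_tensorHom, dagger_id, tensorHom_id]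

theorem dagger_associator_inv (X Y Z : D) : dagger (α_ X Y Z).inv = (α_ X Y Z).hom := by
  rw [← dagger_associator_hom, dagger_dagger]

theorem dagger_leftUnitor_inv (X : D) : dagger (λ_ X).inv = (λ_ X).hom := by
  rw [← dagger_leftUnitor_hom, dagger_dagger]

theorem dagger_rightUnitor_inv (X : D) : dagger (ρ_ X).inv = (ρ_ X).hom := by
  rw [← dagger_rightUnitor_hom, dagger_dagger]

end DaggerMonoidalCategory

open DaggerMonoidalCategory

/-- An endomorphism in a dagger category is positive when it is of the form `g† ∘ g`. -/
def IsPositive {D : Type u} [Category.{v} D] [DaggerCategory D] {X : D} (f : X ⟶ X) : Prop :=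
  ∃ (Y : D) (g : X ⟶ Y), f = g ≫ dagger g

/-- A special dagger Frobenius structure in a dagger monoidal category: an associative, unital,
special multiplication satisfying the Frobenius law
`(1 ⊗ μ) ∘ (μ† ⊗ 1) = (μ ⊗ 1) ∘ (1 ⊗ μ†)`. -/
structure SpecialDaggerFrobenius (D : Type u) [Category.{v} D] [MonoidalCategory D]
    [DaggerMonoidalCategory D] where
  /-- the underlying object -/
  X : D
  /-- the multiplication -/
  mul : X ⊗ X ⟶ X
  /-- the unit -/
  one : 𝟙_ D ⟶ X
  one_mul : one ▷ X ≫ mul = (λ_ X).hom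
  mul_one : X ◁ one ≫ mul = (ρ_ X).hom
  mul_assoc : mul ▷ X ≫ mul = (α_ X X X).hom ≫ X ◁ mul ≫ mul
  special : dagger mul ≫ mul = 𝟙 X
  frobenius : dagger mul ▷ X ≫ (α_ X X X).hom ≫ X ◁ mul =
    X ◁ dagger mul ≫ (α_ X X X).inv ≫ mul ▷ X

section
variable {D : Type u} [Category.{v} D] [MonoidalCategory D] [DaggerMonoidalCategory D]

/-- The Choi matrix `(1 ⊗ μ_B) ∘ (1 ⊗ f ⊗ 1) ∘ (μ_A† ⊗ 1) : A ⊗ B ⟶ A ⊗ B` of `f : A ⟶ B`. -/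
def choi (A B : SpecialDaggerFrobenius D) (f : A.X ⟶ B.X) : A.X ⊗ B.X ⟶ A.X ⊗ B.X :=
  dagger A.mul ▷ B.X ≫ (α_ A.X A.X B.X).hom ≫ A.X ◁ f ▷ B.X ≫ A.X ◁ B.mul

/-- `f` is completely positive when its Choi matrix is positive. -/
def IsCompletelyPositive (A B : SpecialDaggerFrobenius D) (f : A.X ⟶ B.X) : Prop :=
  IsPositive (choi A B f)

namespace SpecialDaggerFrobenius
variable (A : SpecialDaggerFrobenius D)

theorem comul_eq_right : (ρ_ A.X).inv ≫ A.X ◁ (A.one ≫ dagger A.mul) ≫ (α_ A.X A.X A.X).inv ≫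
    A.mul ▷ A.X = dagger A.mul := by
  have h : dagger A.mul ≫ (ρ_ _).inv ≫ (α_ _ _ _).hom ≫ A.X ◁ (A.X ◁ A.one ≫ A.mul) 
    = dagger A.mul := by
    rw [A.mul_one]; monoidal
  calc _ = (ρ_ A.X).inv ≫ A.X ◁ A.one ≫ (A.X ◁ dagger A.mul ≫ (α_ A.X A.X A.X).inv ≫
    A.mul ▷ A.X) := by simp
    _ = (ρ_ A.X).inv ≫ (A.X ◁ A.one ≫ dagger A.mul ▷ A.X) ≫ (α_ A.X A.X A.X).hom ≫
        A.X ◁ A.mul := by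
      rw [← A.frobenius]; simp
    _ = dagger A.mul ≫ (ρ_ _).inv ≫ (α_ _ _ _).hom ≫ A.X ◁ (A.X ◁ A.one ≫ A.mul) := by
      rw [whisker_exchange]; simp
    _ = _ := h

theorem comul_eq_left : (λ_ A.X).inv ≫ (A.one ≫ dagger A.mul) ▷ A.X ≫ (α_ A.X A.X A.X).hom ≫
    A.X ◁ A.mul = dagger A.mul := by
  have h : dagger A.mul ≫ (λ_ _).inv ≫ (α_ _ _ _).inv ≫ (A.one ▷ A.X ≫ A.mul) ▷ A.X
    = dagger A.mul := by
    rw [A.one_mul]; monoidal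
  calc _ = (λ_ A.X).inv ≫ A.one ▷ A.X ≫ (dagger A.mul ▷ A.X ≫ (α_ A.X A.X A.X).hom ≫
    A.X ◁ A.mul) := by simp
    _ = (λ_ A.X).inv ≫ (A.one ▷ A.X ≫ A.X ◁ dagger A.mul) ≫ (α_ A.X A.X A.X).inv ≫
        A.mul ▷ A.X := by
      rw [A.frobenius]; simp
    _ = dagger A.mul ≫ (λ_ _).inv ≫ (α_ _ _ _).inv ≫ (A.one ▷ A.X ≫ A.mul) ▷ A.X := by
      rw [← whisker_exchange]; simp
    _ = _ := h

theorem mul_eq_left : A.X ◁ dagger A.mul ≫ (α_ A.X A.X A.X).inv ≫ 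
    (A.mul ≫ dagger A.one) ▷ A.X ≫ (λ_ A.X).hom = A.mul := by
  have h := congrArg dagger A.comul_eq_left
  simpa only [dagger_comp, dagger_dagger, dagger_whiskerLeft, dagger_whiskerRight,
    dagger_associator_hom, dagger_leftUnitor_inv, Category.assoc] using h

theorem mul_comp_dagger_mul : A.mul ≫ dagger A.mul =
    dagger A.mul ▷ A.X ≫ (α_ A.X A.X A.X).hom ≫ A.X ◁ A.mul := by
  rw [A.frobenius]
  conv_lhs => rw [← A.comul_eq_right]
  conv_rhs => rw [← A.comul_eq_right]
  have := A.mul_assoc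
  have e : A.mul ▷ (A.X ⊗ A.X) ≫ (α_ _ _ _).inv ≫ A.mul ▷ A.X =
    (α_ _ _ _).inv ≫ (A.mul ▷ A.X ≫ A.mul) ▷ A.X := by simp
  calc _ = (ρ_ _).inv ≫ (A.mul ▷ _ ≫ A.X ◁ (A.one ≫ dagger A.mul)) ≫ (α_ A.X A.X A.X).inv ≫
      A.mul ▷ A.X := by simp
    _ = (ρ_ _).inv ≫ (A.X ⊗ A.X) ◁ (A.one ≫ dagger A.mul) ≫ A.mul ▷ (A.X ⊗ A.X) ≫ (α_ _ _ _).inv ≫ A.mul ▷ A.X := by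
      rw [← whisker_exchange]; simp
    _ = _ := by rw [e, A.mul_assoc]; simp

theorem isCompletelyPositive_id : IsCompletelyPositive A A (𝟙 A.X) := by
  refine ⟨A.X, A.mul, ?_⟩
  rw [A.mul_comp_dagger_mul]; simp [choi]

/-- The middle wire in the composite of two Choi matrices is the identity. -/
theorem middle (A : SpecialDaggerFrobenius D) : (ρ_ A.X).inv ≫ A.X ◁ (A.one ≫ dagger A.mul) ≫ 
    (α_ A.X A.X A.X).inv ≫ A.mul ▷ A.X ≫ A.X ◁ dagger A.mul ≫ (α_ A.X A.X A.X).inv ≫ 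
    (A.mul ≫ dagger A.one) ▷ A.X ≫ (λ_ A.X).hom = 𝟙 A.X := by
  have h1 := A.comul_eq_right
  have h2 := A.mul_eq_left
  rw [← A.special]
  conv_rhs => rw [← h1]
  simp only [Category.assoc, h2]

end SpecialDaggerFrobenius

theorem choi_comp (A B C : SpecialDaggerFrobenius D) (f : A.X ⟶ B.X) (g : B.X ⟶ C.X) :
    choi A C (f ≫ g) = (A.X ◁ ((λ_ C.X).inv ≫ (B.one ≫ dagger B.mul) ▷ C.X) ≫
      (A.X ◁ (α_ B.X B.X C.X).hom ≫ (α_ A.X B.X (B.X ⊗ C.X)).inv)) ≫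
      (choi A B f ⊗ₘ choi B C g) ≫ ((α_ A.X B.X (B.X ⊗ C.X)).hom ≫ A.X ◁ (α_ B.X B.X C.X).inv) ≫
      A.X ◁ ((B.mul ≫ dagger B.one) ▷ C.X ≫ (λ_ C.X).hom) := by
  have h := B.middle
  generalize hκ : B.one ≫ dagger B.mul = κ at *
  generalize hκ' : B.mul ≫ dagger B.one = κ' at *
  rw [MonoidalCategory.tensorHom_def]
  unfold choi
  generalize hA : dagger A.mul = δA
  generalize hB : dagger B.mul = δB at *
  have hAh := h
  symm
  calc
    _ = 𝟙 _ ⊗≫ (A.X ◁ ((λ_ C.X).inv ≫ κ ▷ C.X) ≫ δA ▷ ((B.X ⊗ B.X) ⊗ C.X)) ⊗≫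
        A.X ◁ (f ▷ (B.X ⊗ B.X ⊗ C.X)) ⊗≫ A.X ◁ B.mul ▷ (B.X ⊗ C.X) ⊗≫
        (A.X ⊗ B.X) ◁ δB ▷ C.X ⊗≫
        A.X ◁ ((B.X ⊗ B.X) ◁ (g ▷ C.X ≫ C.mul) ≫ κ' ▷ C.X) ⊗≫ 𝟙 _ := by monoidal
    _ = δA ▷ C.X ⊗≫ A.X ◁ (A.X ◁ ((λ_ C.X).inv ≫ κ ▷ C.X) ≫ f ▷ ((B.X ⊗ B.X) ⊗ C.X)) ⊗≫
        A.X ◁ B.mul ▷ (B.X ⊗ C.X) ⊗≫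
        (A.X ⊗ B.X) ◁ δB ▷ C.X ⊗≫
        A.X ◁ (κ' ▷ (B.X ⊗ C.X) ≫ (𝟙_ D) ◁ (g ▷ C.X ≫ C.mul)) ⊗≫ 𝟙 _ := by
      rw [whisker_exchange, whisker_exchange]; monoidal
    _ = δA ▷ C.X ⊗≫ A.X ◁ f ▷ C.X ⊗≫ A.X ◁ ((ρ_ B.X).inv ≫ B.X ◁ κ ≫
          (α_ B.X B.X B.X).inv ≫ B.mul ▷ B.X ≫ B.X ◁ δB ≫ (α_ B.X B.X B.X).inv ≫
          κ' ▷ B.X ≫ (λ_ B.X).hom) ▷ C.X ⊗≫ A.X ◁ (g ▷ C.X ≫ C.mul) := by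
      rw [whisker_exchange]; monoidal
    _ = _ := by rw [h]; monoidal

theorem IsCompletelyPositive.comp {A B C : SpecialDaggerFrobenius D} {f : A.X ⟶ B.X}
    {g : B.X ⟶ C.X} (hf : IsCompletelyPositive A B f) (hg : IsCompletelyPositive B C g) :
    IsCompletelyPositive A C (f ≫ g) := by
  obtain ⟨Y, p, hp⟩ := hf
  obtain ⟨Z, q, hq⟩ := hg
  refine ⟨Y ⊗ Z, (A.X ◁ ((λ_ C.X).inv ≫ (B.one ≫ dagger B.mul) ▷ C.X) ≫
      (A.X ◁ (α_ B.X B.X C.X).hom ≫ (α_ A.X B.X (B.X ⊗ C.X)).inv)) ≫ (p ⊗ₘ q), ?_⟩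
  rw [choi_comp, hp, hq, ← MonoidalCategory.tensorHom_comp_tensorHom]
  simp only [dagger_comp, dagger_dagger, dagger_whiskerLeft, dagger_whiskerRight,
    dagger_associator_hom, dagger_associator_inv, dagger_leftUnitor_inv, dagger_tensorHom,
    Category.assoc]
end

/-- The objects of the category `CP(D)`: the special dagger Frobenius structures in `D`. Only the
dagger monoidal structure of a compact dagger category enters this construction. -/
structure CP (D : Type u) [Category.{v} D] [MonoidalCategory D] [DaggerMonoidalCategory D] where
  /-- the special dagger Frobenius structure -/
  frob : SpecialDaggerFrobenius D

namespace CP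
variable {D : Type u} [Category.{v} D] [MonoidalCategory D] [DaggerMonoidalCategory D]

/-- The morphisms of `CP(D)`: the completely positive morphisms of `D`. -/
@[ext]
structure Hom (A B : CP D) where
  /-- the underlying morphism of `D` -/
  hom : A.frob.X ⟶ B.frob.X
  isCompletelyPositive : IsCompletelyPositive A.frob B.frob hom

instance : Category (CP D) where
  Hom := Hom
  id A := ⟨𝟙 A.frob.X, A.frob.isCompletelyPositive_id⟩
  comp f g := ⟨f.hom ≫ g.hom, f.isCompletelyPositive.comp g.isCompletelyPositive⟩
  id_comp f := Hom.ext (Category.id_comp f.hom)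
  comp_id f := Hom.ext (Category.comp_id f.hom)
  assoc f g h := Hom.ext (Category.assoc f.hom g.hom h.hom)

end CP

/-! ### Relations in a regular category -/

namespace InternalRel

theorem mk_factors_iff {C : Type u} [Category.{v} C] {X Y T : C} (f : Y ⟶ X) [Mono f] (g : T ⟶ X) :
    (Subobject.mk f).Factors g ↔ ∃ h : T ⟶ Y, h ≫ f = g := Iff.rfl

/-- Factorization through a subobject may be checked after precomposing with a strong
epimorphism. -/
theorem factors_of_strongEpi {C : Type u} [Category.{v} C] {X : C} (P : Subobject X) {T T' : C} (e : T' ⟶ T) [StrongEpi e]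
    (f : T ⟶ X) (h : P.Factors (e ≫ f)) : P.Factors f := by
  have sq : CommSq (P.factorThru _ h) e P.arrow f := ⟨by simp⟩
  exact (Subobject.factors_iff _ _).2 ⟨sq.lift, sq.fac_right⟩

section
variable {C : Type u} [Category.{v} C] [Regular C]

/-- A relation `A ⇸ B` in `C`: a subobject of `A ⨯ B`. -/
abbrev Relation (A B : C) : Type max u v := Subobject (A ⨯ B)

/-- `R.Holds a b` for generalized elements `a : T ⟶ A`, `b : T ⟶ B`. -/
def Relation.Holds {A B : C} (R : Relation A B) {T : C} (a : T ⟶ A) (b : T ⟶ B) : Prop :=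
  Subobject.Factors R (prod.lift a b)

/-- The identity relation: the diagonal. -/
noncomputable def Relation.id (A : C) : Relation A A := Subobject.mk (diag A)

/-- The composite `S ∘ R`: the image of the pullback `R ×_B S ⟶ A ⨯ C`. -/
noncomputable def Relation.comp {X Y Z : C} (R : Relation X Y) (S : Relation Y Z) :
    Relation X Z :=
  imageSubobject (prod.lift
    (pullback.fst (R.arrow ≫ prod.snd) (S.arrow ≫ prod.fst) ≫ R.arrow ≫ prod.fst)
    (pullback.snd (R.arrow ≫ prod.snd) (S.arrow ≫ prod.fst) ≫ S.arrow ≫ prod.snd))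

/-- The converse relation: `R†(b, a)` iff `R(a, b)`. -/
noncomputable def Relation.converse {A B : C} (R : Relation A B) : Relation B A :=
  (Subobject.pullback (prod.lift (prod.snd : B ⨯ A ⟶ A) (prod.fst : B ⨯ A ⟶ B))).obj R

/-- The product of relations: `(R × S)((a, a'), (b, b'))` iff `R(a, b)` and `S(a', b')`. -/
noncomputable def Relation.prod {A B A' B' : C} (R : Relation A B) (S : Relation A' B') :
    Relation (A ⨯ A') (B ⨯ B') :=
  (Subobject.pullback (prod.map (prod.fst : A ⨯ A' ⟶ A) (prod.fst : B ⨯ B' ⟶ B))).obj R ⊓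
  (Subobject.pullback (prod.map (prod.snd : A ⨯ A' ⟶ A') (prod.snd : B ⨯ B' ⟶ B'))).obj S

/-- The graph of a morphism, as a relation. -/
noncomputable def Relation.graph {A B : C} (f : A ⟶ B) : Relation A B :=
  Subobject.mk (prod.lift (𝟙 A) f)

namespace Relation

attribute [local simp] prod.lift_fst prod.lift_snd prod.lift_fst_assoc prod.lift_snd_assoc
  pullback.lift_fst_assoc pullback.lift_snd_assoc

theorem le_iff {A B : C} {R S : Relation A B} :
    R ≤ S ↔ ∀ (T : C) (a : T ⟶ A) (b : T ⟶ B), R.Holds a b → S.Holds a b := by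
  constructor
  · intro h T a b hR
    exact Subobject.factors_of_le _ h hR
  · intro h
    refine Subobject.le_of_factors ?_
    have := h (R : C) (Subobject.arrow R ≫ prod.fst) (Subobject.arrow R ≫ prod.snd)
    unfold Holds at this
    rw [← prod.comp_lift, prod.lift_fst_snd, Category.comp_id] at this
    exact this (Subobject.factors_self R)

theorem ext_holds {A B : C} {R S : Relation A B}
    (h : ∀ (T : C) (a : T ⟶ A) (b : T ⟶ B), R.Holds a b ↔ S.Holds a b) : R = S :=
  le_antisymm (le_iff.2 fun T a b => (h T a b).1) (le_iff.2 fun T a b => (h T a b).2)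

theorem Holds.precomp {A B : C} {R : Relation A B} {T T' : C} {a : T ⟶ A} {b : T ⟶ B}
    (h : R.Holds a b) (e : T' ⟶ T) : R.Holds (e ≫ a) (e ≫ b) := by
  unfold Holds
  rw [← prod.comp_lift]
  exact Subobject.factors_of_factors_right e h

theorem Holds.of_strongEpi {A B : C} {R : Relation A B} {T T' : C} {a : T ⟶ A} {b : T ⟶ B}
    (e : T' ⟶ T) [StrongEpi e] (h : R.Holds (e ≫ a) (e ≫ b)) : R.Holds a b := by
  unfold Holds at h
  rw [← prod.comp_lift] at h
  exact factors_of_strongEpi R e _ h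

theorem strongEpi_pullback_fst {X Y Z : C} (f : X ⟶ Z) (g : Y ⟶ Z) [StrongEpi g] :
    StrongEpi (pullback.fst f g) := by
  have : IsRegularEpi g := Regular.isRegularEpi_of_extremalEpi g
  infer_instance

/-- The interpretation of an existential quantifier as an image, in terms of generalized
elements. -/
theorem imageSubobject_factors_iff {X Y : C} (f : X ⟶ Y) {T : C} (t : T ⟶ Y) :
    (imageSubobject f).Factors t ↔
      ∃ (T' : C) (e : T' ⟶ T) (_ : StrongEpi e) (x : T' ⟶ X), x ≫ f = e ≫ t := by
  constructor
  · intro h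
    have hs : StrongEpi (factorThruImageSubobject f) := by
      unfold factorThruImageSubobject
      infer_instance
    refine ⟨_, pullback.fst ((imageSubobject f).factorThru t h) (factorThruImageSubobject f),
      strongEpi_pullback_fst _ _, pullback.snd _ _, ?_⟩
    calc _ = pullback.snd _ _ ≫ factorThruImageSubobject f ≫ (imageSubobject f).arrow := by
          rw [imageSubobject_arrow_comp]
      _ = _ := by rw [← pullback.condition_assoc, Subobject.factorThru_arrow]
  · rintro ⟨T', e, _, x, hx⟩
    refine factors_of_strongEpi _ e t ?_
    rw [← hx]
    exact imageSubobject_factors_comp_self f x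

theorem holds_id_iff {A T : C} {a b : T ⟶ A} : (Relation.id A).Holds a b ↔ a = b := by
  unfold Holds Relation.id
  rw [mk_factors_iff]
  constructor
  · rintro ⟨g, hg⟩
    have h1 := congrArg (· ≫ prod.fst) hg
    have h2 := congrArg (· ≫ prod.snd) hg
    simp at h1 h2
    rw [← h1, ← h2]
  · rintro rfl
    exact ⟨a, by simp⟩

theorem holds_graph_iff {A B T : C} {f : A ⟶ B} {a : T ⟶ A} {b : T ⟶ B} :
    (graph f).Holds a b ↔ a ≫ f = b := by
  unfold Holds graph
  rw [mk_factors_iff]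
  constructor
  · rintro ⟨g, hg⟩
    have h1 := congrArg (· ≫ prod.fst) hg
    have h2 := congrArg (· ≫ prod.snd) hg
    simp at h1 h2
    rw [← h1, ← h2]
  · rintro rfl
    exact ⟨a, by simp⟩

theorem holds_converse_iff {A B T : C} {R : Relation A B} {a : T ⟶ A} {b : T ⟶ B} :
    R.converse.Holds b a ↔ R.Holds a b := by
  unfold Holds converse
  rw [pullback_factors_iff]
  simp

theorem holds_prod_iff {A B A' B' T : C} {R : Relation A B} {S : Relation A' B'}
    {a : T ⟶ A ⨯ A'} {b : T ⟶ B ⨯ B'} : (Relation.prod R S).Holds a b ↔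
      R.Holds (a ≫ prod.fst) (b ≫ prod.fst) ∧ S.Holds (a ≫ prod.snd) (b ≫ prod.snd) := by
  unfold Holds Relation.prod
  rw [Subobject.inf_factors, pullback_factors_iff, pullback_factors_iff]
  simp

theorem holds_comp_iff {X Y Z T : C} {R : Relation X Y} {S : Relation Y Z} {a : T ⟶ X}
    {c : T ⟶ Z} : (R.comp S).Holds a c ↔ ∃ (T' : C) (e : T' ⟶ T) (_ : StrongEpi e) (b : T' ⟶ Y),
      R.Holds (e ≫ a) b ∧ S.Holds b (e ≫ c) := by
  unfold Holds Relation.comp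
  rw [imageSubobject_factors_iff]
  constructor
  · rintro ⟨T', e, he, x, hx⟩
    have h1 := congrArg (· ≫ prod.fst) hx
    have h2 := congrArg (· ≫ prod.snd) hx
    simp only [Category.assoc, prod.lift_fst, prod.lift_snd] at h1 h2
    refine ⟨T', e, he, x ≫ pullback.fst _ _ ≫ R.arrow ≫ prod.snd, ?_, ?_⟩
    · rw [← h1]
      have : prod.lift (x ≫ pullback.fst (R.arrow ≫ prod.snd) (S.arrow ≫ prod.fst) ≫
        R.arrow ≫ prod.fst) (x ≫ pullback.fst (R.arrow ≫ prod.snd) (S.arrow ≫ prod.fst) ≫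
        R.arrow ≫ prod.snd) = (x ≫ pullback.fst _ _) ≫ R.arrow := by
        ext <;> simp
      rw [this]
      exact Subobject.factors_comp_arrow _
    · rw [← h2, pullback.condition]
      have : prod.lift (x ≫ pullback.snd (R.arrow ≫ prod.snd) (S.arrow ≫ prod.fst) ≫
        S.arrow ≫ prod.fst) (x ≫ pullback.snd (R.arrow ≫ prod.snd) (S.arrow ≫ prod.fst) ≫
        S.arrow ≫ prod.snd) = (x ≫ pullback.snd _ _) ≫ S.arrow := by
        ext <;> simp
      rw [this]
      exact Subobject.factors_comp_arrow _
  · rintro ⟨T', e, he, b, hR, hS⟩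
    refine ⟨T', e, he, pullback.lift (Subobject.factorThru R _ hR) (Subobject.factorThru S _ hS)
      (by simp), ?_⟩
    ext <;> simp

theorem holds_comp_of {X Y Z T : C} {R : Relation X Y} {S : Relation Y Z} {a : T ⟶ X}
    {b : T ⟶ Y} {c : T ⟶ Z} (h : R.Holds a b) (h' : S.Holds b c) : (R.comp S).Holds a c :=
  holds_comp_iff.2 ⟨T, 𝟙 T, inferInstance, b, by simpa using h, by simpa using h'⟩

theorem holds_graph_comp_iff {X Y Z T : C} {f : X ⟶ Y} {S : Relation Y Z} {a : T ⟶ X}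
    {c : T ⟶ Z} : ((graph f).comp S).Holds a c ↔ S.Holds (a ≫ f) c := by
  rw [holds_comp_iff]
  constructor
  · rintro ⟨T', e, he, b, h, h'⟩
    rw [holds_graph_iff] at h
    subst h
    rw [Category.assoc] at h'
    exact h'.of_strongEpi e
  · intro h
    exact ⟨T, 𝟙 T, inferInstance, a ≫ f, by simp [holds_graph_iff], by simpa using h⟩

theorem holds_comp_graph_iff {X Y Z T : C} {f : Y ≅ Z} {R : Relation X Y} {a : T ⟶ X}
    {c : T ⟶ Z} : (R.comp (graph f.hom)).Holds a c ↔ R.Holds a (c ≫ f.inv) := by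
  rw [holds_comp_iff]
  constructor
  · rintro ⟨T', e, he, b, h, h'⟩
    rw [holds_graph_iff] at h'
    refine Holds.of_strongEpi e ?_
    rw [← Category.assoc, ← h']
    simpa using h
  · intro h
    exact ⟨T, 𝟙 T, inferInstance, c ≫ f.inv, by simpa using h, by simp [holds_graph_iff]⟩

theorem id_comp {X Y : C} (R : Relation X Y) : (Relation.id X).comp R = R := by
  refine ext_holds fun T a b => ?_
  rw [holds_comp_iff]
  constructor
  · rintro ⟨T', e, he, x, h, h'⟩
    rw [holds_id_iff] at h
    subst h
    exact h'.of_strongEpi e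
  · intro h
    exact holds_comp_iff.1 (holds_comp_of (holds_id_iff.2 rfl) h)

theorem comp_id {X Y : C} (R : Relation X Y) : R.comp (Relation.id Y) = R := by
  refine ext_holds fun T a b => ?_
  rw [holds_comp_iff]
  constructor
  · rintro ⟨T', e, he, x, h, h'⟩
    rw [holds_id_iff] at h'
    subst h'
    exact h.of_strongEpi e
  · intro h
    exact holds_comp_iff.1 (holds_comp_of h (holds_id_iff.2 rfl))

theorem comp_assoc {W X Y Z : C} (R : Relation W X) (S : Relation X Y) (Q : Relation Y Z) :
    (R.comp S).comp Q = R.comp (S.comp Q) := by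
  refine ext_holds fun T a b => ?_
  rw [holds_comp_iff, holds_comp_iff]
  constructor
  · rintro ⟨T', e, he, y, h, h'⟩
    obtain ⟨T'', e', he', x, h1, h2⟩ := holds_comp_iff.1 h
    refine ⟨T'', e' ≫ e, strongEpi_comp _ _, x, by simpa using h1, ?_⟩
    have := h'.precomp e'
    exact holds_comp_of h2 (by simpa using this)
  · rintro ⟨T', e, he, x, h, h'⟩
    obtain ⟨T'', e', he', y, h1, h2⟩ := holds_comp_iff.1 h'
    refine ⟨T'', e' ≫ e, strongEpi_comp _ _, y, ?_, by simpa using h2⟩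
    have := h.precomp e'
    exact holds_comp_of (by simpa using this) h1

theorem graph_id (X : C) : graph (𝟙 X) = Relation.id X :=
  ext_holds fun T a b => by rw [holds_graph_iff, holds_id_iff, Category.comp_id]

theorem graph_comp {X Y Z : C} (f : X ⟶ Y) (g : Y ⟶ Z) :
    (graph f).comp (graph g) = graph (f ≫ g) :=
  ext_holds fun T a b => by
    rw [holds_graph_comp_iff, holds_graph_iff, holds_graph_iff, Category.assoc]

theorem converse_id (X : C) : (Relation.id X).converse = Relation.id X :=
  ext_holds fun T a b => by rw [holds_converse_iff, holds_id_iff, holds_id_iff, eq_comm]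

theorem converse_comp {X Y Z : C} (R : Relation X Y) (S : Relation Y Z) :
    (R.comp S).converse = S.converse.comp R.converse :=
  ext_holds fun T a b => by
    rw [holds_converse_iff, holds_comp_iff, holds_comp_iff]
    simp only [holds_converse_iff, and_comm]

theorem converse_converse {X Y : C} (R : Relation X Y) : R.converse.converse = R :=
  ext_holds fun T a b => by rw [holds_converse_iff, holds_converse_iff]

theorem converse_graph {X Y : C} (f : X ≅ Y) : (graph f.hom).converse = graph f.inv :=
  ext_holds fun T a b => by
    rw [holds_converse_iff, holds_graph_iff, holds_graph_iff, ← Iso.eq_comp_inv, eq_comm]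

theorem converse_prod {X Y X' Y' : C} (R : Relation X Y) (S : Relation X' Y') :
    (Relation.prod R S).converse = Relation.prod R.converse S.converse :=
  ext_holds fun T a b => by
    simp only [holds_converse_iff, holds_prod_iff]

theorem prod_id (X Y : C) : Relation.prod (Relation.id X) (Relation.id Y) = Relation.id (X ⨯ Y) :=
  ext_holds fun T a b => by
    rw [holds_prod_iff, holds_id_iff, holds_id_iff, holds_id_iff]
    exact ⟨fun h => Limits.prod.hom_ext h.1 h.2, fun h => by simp [h]⟩

theorem prod_graph {X Y X' Y' : C} (f : X ⟶ Y) (g : X' ⟶ Y') :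
    Relation.prod (graph f) (graph g) = graph (prod.map f g) :=
  ext_holds fun T a b => by
    rw [holds_prod_iff, holds_graph_iff, holds_graph_iff, holds_graph_iff]
    constructor
    · intro h
      refine Limits.prod.hom_ext ?_ ?_
      · simpa using h.1
      · simpa using h.2
    · rintro rfl
      simp

theorem prod_comp_prod {X Y Z X' Y' Z' : C} (R : Relation X Y) (R' : Relation X' Y')
    (S : Relation Y Z) (S' : Relation Y' Z') :
    (Relation.prod R R').comp (Relation.prod S S') =
      Relation.prod (R.comp S) (R'.comp S') := by
  refine ext_holds fun T a b => ?_
  rw [holds_prod_iff, holds_comp_iff, holds_comp_iff, holds_comp_iff]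
  constructor
  · rintro ⟨T', e, he, y, h, h'⟩
    rw [holds_prod_iff] at h h'
    exact ⟨⟨T', e, he, y ≫ prod.fst, by simpa using h.1, by simpa using h'.1⟩,
      ⟨T', e, he, y ≫ prod.snd, by simpa using h.2, by simpa using h'.2⟩⟩
  · rintro ⟨⟨T₁, e₁, he₁, y₁, h₁, h₁'⟩, ⟨T₂, e₂, he₂, y₂, h₂, h₂'⟩⟩
    have := strongEpi_pullback_fst e₁ e₂
    refine ⟨pullback e₁ e₂, pullback.fst e₁ e₂ ≫ e₁, strongEpi_comp _ _,
      prod.lift (pullback.fst e₁ e₂ ≫ y₁) (pullback.snd e₁ e₂ ≫ y₂), ?_, ?_⟩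
    · rw [holds_prod_iff]
      refine ⟨by simpa using h₁.precomp (pullback.fst e₁ e₂), ?_⟩
      rw [pullback.condition]
      simpa using h₂.precomp (pullback.snd e₁ e₂)
    · rw [holds_prod_iff]
      refine ⟨by simpa using h₁'.precomp (pullback.fst e₁ e₂), ?_⟩
      rw [pullback.condition]
      simpa using h₂'.precomp (pullback.snd e₁ e₂)


theorem prod_comp_associator {X Y Z X' Y' Z' : C} (R : Relation X X') (S : Relation Y Y')
    (Q : Relation Z Z') :
    (Relation.prod (Relation.prod R S) Q).comp (graph (Limits.prod.associator X' Y' Z').hom) =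
      (graph (Limits.prod.associator X Y Z).hom).comp (Relation.prod R (Relation.prod S Q)) := by
  refine ext_holds fun T a b => ?_
  rw [holds_comp_graph_iff, holds_graph_comp_iff]
  simp only [holds_prod_iff, Limits.prod.associator_hom, Limits.prod.associator_inv,
    Category.assoc, prod.lift_fst, prod.lift_snd, and_assoc]

theorem prod_comp_leftUnitor {X X' : C} (R : Relation X X') :
    (Relation.prod (Relation.id (⊤_ C)) R).comp (graph (Limits.prod.leftUnitor X').hom) =
      (graph (Limits.prod.leftUnitor X).hom).comp R := by
  refine ext_holds fun T a b => ?_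
  rw [holds_comp_graph_iff, holds_graph_comp_iff, holds_prod_iff]
  simp [holds_id_iff, eq_iff_true_of_subsingleton]

theorem prod_comp_rightUnitor {X X' : C} (R : Relation X X') :
    (Relation.prod R (Relation.id (⊤_ C))).comp (graph (Limits.prod.rightUnitor X').hom) =
      (graph (Limits.prod.rightUnitor X).hom).comp R := by
  refine ext_holds fun T a b => ?_
  rw [holds_comp_graph_iff, holds_graph_comp_iff, holds_prod_iff]
  simp [holds_id_iff, eq_iff_true_of_subsingleton]

end Relation

/-- The objects of `Rel(C)`: the objects of `C`. -/
structure RelOf (C : Type u) where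
  /-- the underlying object of `C` -/
  obj : C

namespace RelOf

/-- The category `Rel(C)`. -/
noncomputable instance : Category.{max u v} (RelOf C) where
  Hom A B := Relation A.obj B.obj
  id A := Relation.id A.obj
  comp R S := Relation.comp R S
  id_comp R := Relation.id_comp R
  comp_id R := Relation.comp_id R
  assoc R S Q := Relation.comp_assoc R S Q

/-- An isomorphism of `C` as an isomorphism of `Rel(C)`. -/
noncomputable def graphIso {X Y : C} (f : X ≅ Y) : (⟨X⟩ : RelOf C) ≅ ⟨Y⟩ where
  hom := Relation.graph f.hom
  inv := Relation.graph f.inv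
  hom_inv_id := (Relation.graph_comp _ _).trans (by rw [f.hom_inv_id, Relation.graph_id]; rfl)
  inv_hom_id := (Relation.graph_comp _ _).trans (by rw [f.inv_hom_id, Relation.graph_id]; rfl)

noncomputable instance : MonoidalCategoryStruct (RelOf C) where
  tensorObj A B := ⟨A.obj ⨯ B.obj⟩
  whiskerLeft A _ _ R := Relation.prod (Relation.id A.obj) R
  whiskerRight R B := Relation.prod R (Relation.id B.obj)
  tensorHom R S := Relation.prod R S
  tensorUnit := ⟨⊤_ C⟩
  associator A B D := graphIso (Limits.prod.associator A.obj B.obj D.obj)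
  leftUnitor A := graphIso (Limits.prod.leftUnitor A.obj)
  rightUnitor A := graphIso (Limits.prod.rightUnitor A.obj)

noncomputable instance : MonoidalCategory (RelOf C) :=
  MonoidalCategory.ofTensorHom
    (id_tensorHom_id := fun A B => Relation.prod_id A.obj B.obj)
    (id_tensorHom := fun _ _ _ _ => rfl)
    (tensorHom_id := fun _ _ => rfl)
    (tensorHom_comp_tensorHom := fun R R' S S' => Relation.prod_comp_prod R R' S S')
    (associator_naturality := fun R S Q => Relation.prod_comp_associator R S Q)
    (leftUnitor_naturality := fun R => Relation.prod_comp_leftUnitor R)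
    (rightUnitor_naturality := fun R => Relation.prod_comp_rightUnitor R)
    (pentagon := fun W X Y Z => by
      change (Relation.prod (Relation.graph _) (Relation.id _)).comp
        ((Relation.graph _).comp (Relation.prod (Relation.id _) (Relation.graph _))) =
        (Relation.graph _).comp (Relation.graph _)
      rw [← Relation.graph_id, ← Relation.graph_id, Relation.prod_graph, Relation.prod_graph,
        Relation.graph_comp, Relation.graph_comp, Relation.graph_comp]
      exact congrArg Relation.graph (Limits.prod.pentagon W.obj X.obj Y.obj Z.obj))
    (triangle := fun X Y => by
      change (Relation.graph _).comp (Relation.prod (Relation.id _) (Relation.graph _)) =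
        Relation.prod (Relation.graph _) (Relation.id _)
      rw [← Relation.graph_id, ← Relation.graph_id, Relation.prod_graph, Relation.prod_graph,
        Relation.graph_comp]
      exact congrArg Relation.graph (Limits.prod.triangle X.obj Y.obj))

noncomputable instance : DaggerMonoidalCategory (RelOf C) where
  dagger R := Relation.converse R
  dagger_id A := Relation.converse_id A.obj
  dagger_comp R S := Relation.converse_comp R S
  dagger_dagger R := Relation.converse_converse R
  dagger_tensorHom R S := Relation.converse_prod R S
  dagger_associator_hom _ _ _ := Relation.converse_graph (Limits.prod.associator _ _ _)
  dagger_leftUnitor_hom _ := Relation.converse_graph (Limits.prod.leftUnitor _)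
  dagger_rightUnitor_hom _ := Relation.converse_graph (Limits.prod.rightUnitor _)

end RelOf

/-- `R` is reflexive: `⟦a ∈ A | R(a, a)⟧ = A`. -/
def Relation.IsReflexive {A : C} (R : Relation A A) : Prop :=
  (Subobject.pullback (diag A)).obj R = ⊤

/-- `R` is symmetric: `R(a, b)` iff `R(b, a)`. -/
def Relation.IsSymmetric {A : C} (R : Relation A A) : Prop :=
  R.converse = R

/-- A regular category is positively regular when every reflexive symmetric relation in it is
positive, that is, of the form `S† ∘ S` for some relation `S`. -/
def IsPositivelyRegular (C : Type u) [Category.{v} C] [Regular C] : Prop :=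
  ∀ (A : RelOf C) (R : A ⟶ A), Relation.IsReflexive R → Relation.IsSymmetric R → IsPositive R

end

/-! ### Internal groupoids and relations respecting inverses -/

/-- An internal groupoid in a category with pullbacks. Composition is defined on the pullback
`C₁ ×_{C₀} C₁` of pairs `(a, b)` with `s(a) = t(b)`, and `m(a, b)` is `a ∘ b`. Associativity is
stated for generalized elements. -/
structure InternalGroupoid (C : Type u) [Category.{v} C] [HasPullbacks C] where
  /-- the object of objects -/
  C₀ : C
  /-- the object of morphisms -/
  C₁ : C
  /-- source -/
  s : C₁ ⟶ C₀
  /-- target -/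
  t : C₁ ⟶ C₀
  /-- identities -/
  u : C₀ ⟶ C₁
  /-- composition -/
  m : pullback s t ⟶ C₁
  /-- inversion -/
  i : C₁ ⟶ C₁
  u_s : u ≫ s = 𝟙 C₀
  u_t : u ≫ t = 𝟙 C₀
  m_s : m ≫ s = pullback.snd s t ≫ s
  m_t : m ≫ t = pullback.fst s t ≫ t
  /-- `a ∘ id = a` -/
  comp_id : pullback.lift (𝟙 C₁) (s ≫ u) (by simp [u_t]) ≫ m = 𝟙 C₁
  /-- `id ∘ a = a` -/
  id_comp : pullback.lift (t ≫ u) (𝟙 C₁) (by simp [u_s]) ≫ m = 𝟙 C₁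
  /-- `(a ∘ b) ∘ c = a ∘ (b ∘ c)` -/
  assoc : ∀ {T : C} (a b c : T ⟶ C₁) (hab : a ≫ s = b ≫ t) (hbc : b ≫ s = c ≫ t),
    pullback.lift (pullback.lift a b hab ≫ m) c
        (by rw [Category.assoc, m_s, pullback.lift_snd_assoc, hbc]) ≫ m =
      pullback.lift a (pullback.lift b c hbc ≫ m)
        (by rw [Category.assoc, m_t, pullback.lift_fst_assoc, hab]) ≫ m
  i_s : i ≫ s = t
  i_t : i ≫ t = s
  /-- `a ∘ a⁻¹ = id` -/
  comp_inv : pullback.lift (𝟙 C₁) i (by rw [Category.id_comp, i_t]) ≫ m = t ≫ u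
  /-- `a⁻¹ ∘ a = id` -/
  inv_comp : pullback.lift i (𝟙 C₁) (by rw [Category.id_comp, i_s]) ≫ m = s ≫ u

section
variable {C : Type u} [Category.{v} C] [Regular C]

/-- A relation `R : G₁ ⇸ H₁` between internal groupoids respects inverses when
`R(a, b) ⇒ R(a⁻¹, b⁻¹) ∧ R(id_{dom a}, id_{dom b})`. -/
def RespectsInverses (G H : InternalGroupoid C) (R : Relation G.C₁ H.C₁) : Prop :=
  R ≤ (Subobject.pullback (prod.map G.i H.i)).obj R ⊓
    (Subobject.pullback (prod.map (G.s ≫ G.u) (H.s ≫ H.u))).obj R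

theorem respectsInverses_iff {G H : InternalGroupoid C} {R : Relation G.C₁ H.C₁} :
    RespectsInverses G H R ↔ ∀ (T : C) (a : T ⟶ G.C₁) (b : T ⟶ H.C₁), R.Holds a b →
      R.Holds (a ≫ G.i) (b ≫ H.i) ∧ R.Holds (a ≫ G.s ≫ G.u) (b ≫ H.s ≫ H.u) := by
  unfold RespectsInverses
  rw [Relation.le_iff]
  unfold Relation.Holds
  simp only [Subobject.inf_factors, pullback_factors_iff, prod.lift_map]

theorem respectsInverses_id (G : InternalGroupoid C) :
    RespectsInverses G G (Relation.id G.C₁) := by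
  rw [respectsInverses_iff]
  intro T a b h
  rw [Relation.holds_id_iff] at h
  subst h
  exact ⟨Relation.holds_id_iff.2 rfl, Relation.holds_id_iff.2 rfl⟩

theorem RespectsInverses.comp {G H K : InternalGroupoid C} {R : Relation G.C₁ H.C₁}
    {S : Relation H.C₁ K.C₁} (hR : RespectsInverses G H R) (hS : RespectsInverses H K S) :
    RespectsInverses G K (R.comp S) := by
  rw [respectsInverses_iff] at hR hS ⊢
  intro T a c h
  obtain ⟨T', e, he, b, h₁, h₂⟩ := Relation.holds_comp_iff.1 h
  have h₁' := hR _ _ _ h₁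
  have h₂' := hS _ _ _ h₂
  simp only [Category.assoc] at h₁' h₂'
  exact ⟨Relation.holds_comp_iff.2 ⟨T', e, he, b ≫ H.i, h₁'.1, h₂'.1⟩,
    Relation.holds_comp_iff.2 ⟨T', e, he, b ≫ H.s ≫ H.u, h₁'.2, h₂'.2⟩⟩

/-- The objects of the category of groupoids in `C` and relations respecting inverses. -/
structure GpdRel (C : Type u) [Category.{v} C] [Regular C] where
  /-- the internal groupoid -/
  gpd : InternalGroupoid C

namespace GpdRel

/-- The morphisms of the category of groupoids in `C` and relations respecting inverses. -/
@[ext]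
structure Hom (G H : GpdRel C) where
  /-- the underlying relation between the objects of morphisms -/
  rel : Relation G.gpd.C₁ H.gpd.C₁
  respectsInverses : RespectsInverses G.gpd H.gpd rel

noncomputable instance : Category (GpdRel C) where
  Hom := Hom
  id G := ⟨Relation.id G.gpd.C₁, respectsInverses_id G.gpd⟩
  comp f g := ⟨f.rel.comp g.rel, f.respectsInverses.comp g.respectsInverses⟩
  id_comp f := Hom.ext (Relation.id_comp f.rel)
  comp_id f := Hom.ext (Relation.comp_id f.rel)
  assoc f g h := Hom.ext (Relation.comp_assoc f.rel g.rel h.rel)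

end GpdRel

end
end InternalRel

/-! A special dagger Frobenius structure in `Rel(C)` is, read through generalized elements, a
groupoid, and complete positivity of a relation between two such structures is exactly compatibility
with inverses. The equivalence is the functor `GpdRel.toCP`, which takes composition and identities
of a groupoid as relations and leaves the relations between groupoids unchanged.

Full faithfulness. In a groupoid the intermediate elements in the Choi matrix of `R` are forced: it
relates (a, b) to (a', b') exactly when R(a'⁻¹a, b'b⁻¹), with both products defined. A positive
relation is symmetric and is reflexive wherever it relates anything. In a positively regular
category the converse holds as well (`isPositive_of_holds`). For the Choi matrix, symmetry amounts
to R(x⁻¹, y⁻¹) and partial reflexivity to R(id, id), whenever R(x, y).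

Essential surjectivity. Given a Frobenius structure, the special law makes the multiplication a
partial function, the unit laws give each element unique left and right units, and the Frobenius law
gives inverses. Images provide such witnesses only after passing to a cover; each is unique, so it
descends along the strong epimorphism. Applied to the universal element 𝟙 and the universal
composable pair, these statements become the structure morphisms of an internal groupoid. This half
uses only regularity. -/

namespace InternalRel

/-! ### Generalized elements in `C` and in `Rel(C)` -/

section
variable {C : Type u} [Category.{v} C] [Regular C]

/-- Generalized elements descend uniquely along strong epimorphisms. -/
theorem exists_desc_of_strongEpi {T T' Y : C} (e : T' ⟶ T) [StrongEpi e] (b : T' ⟶ Y)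
    (h : ∀ (S : C) (p q : S ⟶ T'), p ≫ e = q ≫ e → p ≫ b = q ≫ b) : ∃ c, e ≫ c = b := by
  -- Strong epimorphisms in a regular category are regular, so `e` is a coequalizer and
  -- compatibility on the pair it coequalizes suffices.
  have : IsRegularEpi e := Regular.isRegularEpi_of_extremalEpi e
  obtain ⟨c, hc⟩ := (IsRegularEpi.getStruct e).desc' b
    (h _ _ _ (IsRegularEpi.getStruct e).w)
  exact ⟨c, hc⟩

namespace RelOf

/-- `Holds R a b` for a morphism `R` of `Rel(C)` and generalized elements `a`, `b`. -/
def Holds {A B : RelOf C} (R : A ⟶ B) {T : C} (a : T ⟶ A.obj) (b : T ⟶ B.obj) : Prop :=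
  Relation.Holds (show Relation A.obj B.obj from R) a b

variable {A B D E : RelOf C} {T : C}

theorem ext_holds {R S : A ⟶ B}
    (h : ∀ (T : C) (a : T ⟶ A.obj) (b : T ⟶ B.obj), Holds R a b ↔ Holds S a b) : R = S :=
  Relation.ext_holds h

theorem Holds.precomp {R : A ⟶ B} {T' : C} {a : T ⟶ A.obj} {b : T ⟶ B.obj} (h : Holds R a b)
    (e : T' ⟶ T) : Holds R (e ≫ a) (e ≫ b) :=
  Relation.Holds.precomp h e

theorem Holds.of_strongEpi {R : A ⟶ B} {T' : C} {a : T ⟶ A.obj} {b : T ⟶ B.obj}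
    (e : T' ⟶ T) [StrongEpi e] (h : Holds R (e ≫ a) (e ≫ b)) : Holds R a b :=
  Relation.Holds.of_strongEpi e h

theorem holds_id {a b : T ⟶ A.obj} : Holds (𝟙 A) a b ↔ a = b :=
  Relation.holds_id_iff

theorem holds_dagger {R : A ⟶ B} {a : T ⟶ A.obj} {b : T ⟶ B.obj} :
    Holds (dagger R) b a ↔ Holds R a b :=
  Relation.holds_converse_iff

theorem holds_comp {R : A ⟶ B} {S : B ⟶ D} {a : T ⟶ A.obj} {c : T ⟶ D.obj} :
    Holds (R ≫ S) a c ↔ ∃ (T' : C) (e : T' ⟶ T) (_ : StrongEpi e) (b : T' ⟶ B.obj),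
      Holds R (e ≫ a) b ∧ Holds S b (e ≫ c) :=
  Relation.holds_comp_iff

theorem holds_comp_of {R : A ⟶ B} {S : B ⟶ D} {a : T ⟶ A.obj} {b : T ⟶ B.obj} {c : T ⟶ D.obj}
    (h : Holds R a b) (h' : Holds S b c) : Holds (R ≫ S) a c :=
  Relation.holds_comp_of h h'

/-- Pairs of generalized elements, as generalized elements of the tensor product. -/
noncomputable def pair (a : T ⟶ A.obj) (b : T ⟶ B.obj) : T ⟶ (A ⊗ B).obj :=
  prod.lift a b

@[simp]
theorem comp_pair {T' : C} (e : T' ⟶ T) (a : T ⟶ A.obj) (b : T ⟶ B.obj) :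
    e ≫ pair a b = pair (e ≫ a) (e ≫ b) :=
  prod.comp_lift _ _ _

theorem exists_pair (x : T ⟶ (A ⊗ B).obj) : ∃ (a : T ⟶ A.obj) (b : T ⟶ B.obj), x = pair a b :=
  ⟨x ≫ (prod.fst : A.obj ⨯ B.obj ⟶ _), x ≫ (prod.snd : A.obj ⨯ B.obj ⟶ _),
    Limits.prod.hom_ext (prod.lift_fst _ _).symm (prod.lift_snd _ _).symm⟩

theorem pair_inj {a a' : T ⟶ A.obj} {b b' : T ⟶ B.obj} :
    pair a b = pair a' b' ↔ a = a' ∧ b = b' := by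
  refine ⟨fun h => ⟨?_, ?_⟩, fun h => by rw [h.1, h.2]⟩
  · exact (prod.lift_fst a b).symm.trans
      ((congrArg (· ≫ (prod.fst : A.obj ⨯ B.obj ⟶ _)) h).trans (prod.lift_fst a' b'))
  · exact (prod.lift_snd a b).symm.trans
      ((congrArg (· ≫ (prod.snd : A.obj ⨯ B.obj ⟶ _)) h).trans (prod.lift_snd a' b'))

theorem holds_tensorHom {A' B' : RelOf C} {R : A ⟶ B} {S : A' ⟶ B'} {a : T ⟶ A.obj}
    {a' : T ⟶ A'.obj} {b : T ⟶ B.obj} {b' : T ⟶ B'.obj} :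
    Holds (R ⊗ₘ S) (pair a a') (pair b b') ↔ Holds R a b ∧ Holds S a' b' := by
  refine (Relation.holds_prod_iff (R := R) (S := S)).trans ?_
  simp only [pair, prod.lift_fst, prod.lift_snd]
  rfl

theorem holds_whiskerRight {R : A ⟶ B} {a : T ⟶ A.obj} {b : T ⟶ B.obj} {d d' : T ⟶ D.obj} :
    Holds (R ▷ D) (pair a d) (pair b d') ↔ Holds R a b ∧ d = d' := by
  rw [← tensorHom_id, holds_tensorHom, holds_id]

theorem holds_whiskerLeft {R : A ⟶ B} {a : T ⟶ A.obj} {b : T ⟶ B.obj} {d d' : T ⟶ D.obj} :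
    Holds (D ◁ R) (pair d a) (pair d' b) ↔ d = d' ∧ Holds R a b := by
  rw [← id_tensorHom, holds_tensorHom, holds_id]

theorem lift_associator_hom {X Y Z T : C} (a : T ⟶ X) (b : T ⟶ Y) (c : T ⟶ Z) :
    prod.lift (prod.lift a b) c ≫ (Limits.prod.associator X Y Z).hom =
      prod.lift a (prod.lift b c) := by
  refine Limits.prod.hom_ext ?_ (Limits.prod.hom_ext ?_ ?_) <;>
    simp [prod.lift_fst, prod.lift_snd, prod.lift_fst_assoc]

theorem holds_associator_hom_comp {S : A ⊗ (B ⊗ D) ⟶ E} {a : T ⟶ A.obj} {b : T ⟶ B.obj}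
    {d : T ⟶ D.obj} {x : T ⟶ E.obj} :
    Holds ((α_ A B D).hom ≫ S) (pair (pair a b) d) x ↔ Holds S (pair a (pair b d)) x := by
  refine (Relation.holds_graph_comp_iff
    (f := (Limits.prod.associator A.obj B.obj D.obj).hom) (S := S)).trans ?_
  rw [show pair (pair a b) d ≫ (Limits.prod.associator A.obj B.obj D.obj).hom =
    pair a (pair b d) from ?_]
  · rfl
  · exact lift_associator_hom a b d

theorem holds_leftUnitor_hom {x : T ⟶ (𝟙_ (RelOf C)).obj} {a b : T ⟶ A.obj} :
    Holds (λ_ A).hom (pair x a) b ↔ a = b := by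
  refine (Relation.holds_graph_iff (f := (Limits.prod.leftUnitor A.obj).hom)).trans ?_
  rw [show pair x a ≫ (Limits.prod.leftUnitor A.obj).hom = a from prod.lift_snd _ _]

theorem holds_rightUnitor_hom {x : T ⟶ (𝟙_ (RelOf C)).obj} {a b : T ⟶ A.obj} :
    Holds (ρ_ A).hom (pair a x) b ↔ a = b := by
  refine (Relation.holds_graph_iff (f := (Limits.prod.rightUnitor A.obj).hom)).trans ?_
  rw [show pair a x ≫ (Limits.prod.rightUnitor A.obj).hom = a from prod.lift_fst _ _]

/-- Morphisms out of a tensor product may be compared on pairs. -/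
theorem ext_pair {R S : A ⊗ B ⟶ D}
    (h : ∀ (T : C) (a : T ⟶ A.obj) (b : T ⟶ B.obj) (d : T ⟶ D.obj),
      Holds R (pair a b) d ↔ Holds S (pair a b) d) : R = S := by
  refine ext_holds fun T x d => ?_
  obtain ⟨a, b, rfl⟩ := exists_pair x
  exact h T a b d

theorem holds_whiskerRight_comp {R : A ⟶ B} {S : B ⊗ D ⟶ E} {a : T ⟶ A.obj} {d : T ⟶ D.obj}
    {x : T ⟶ E.obj} : Holds (R ▷ D ≫ S) (pair a d) x ↔
      ∃ (T' : C) (e : T' ⟶ T) (_ : StrongEpi e) (b : T' ⟶ B.obj),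
        Holds R (e ≫ a) b ∧ Holds S (pair b (e ≫ d)) (e ≫ x) := by
  rw [holds_comp]
  constructor
  · rintro ⟨T', e, he, y, h, h'⟩
    obtain ⟨b, d', rfl⟩ := exists_pair y
    rw [comp_pair, holds_whiskerRight] at h
    obtain ⟨h, rfl⟩ := h
    exact ⟨T', e, he, b, h, h'⟩
  · rintro ⟨T', e, he, b, h, h'⟩
    exact ⟨T', e, he, pair b (e ≫ d), by rw [comp_pair, holds_whiskerRight]; exact ⟨h, rfl⟩, h'⟩

theorem holds_whiskerLeft_comp {R : A ⟶ B} {S : D ⊗ B ⟶ E} {a : T ⟶ A.obj} {d : T ⟶ D.obj}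
    {x : T ⟶ E.obj} : Holds (D ◁ R ≫ S) (pair d a) x ↔
      ∃ (T' : C) (e : T' ⟶ T) (_ : StrongEpi e) (b : T' ⟶ B.obj),
        Holds R (e ≫ a) b ∧ Holds S (pair (e ≫ d) b) (e ≫ x) := by
  rw [holds_comp]
  constructor
  · rintro ⟨T', e, he, y, h, h'⟩
    obtain ⟨d', b, rfl⟩ := exists_pair y
    rw [comp_pair, holds_whiskerLeft] at h
    obtain ⟨rfl, h⟩ := h
    exact ⟨T', e, he, b, h, h'⟩
  · rintro ⟨T', e, he, b, h, h'⟩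
    exact ⟨T', e, he, pair (e ≫ d) b, by rw [comp_pair, holds_whiskerLeft]; exact ⟨rfl, h⟩, h'⟩

/-- The relation `(1 ⊗ ν) ∘ (μ† ⊗ 1)` in terms of generalized elements. -/
theorem holds_dagger_whiskerRight_comp {A' B' : RelOf C} {R : A' ⊗ A ⟶ A} {f : A ⊗ B ⟶ B'}
    {a : T ⟶ A.obj} {b : T ⟶ B.obj} {a' : T ⟶ A'.obj} {b' : T ⟶ B'.obj} :
    Holds (dagger R ▷ B ≫ (α_ A' A B).hom ≫ A' ◁ f) (pair a b) (pair a' b') ↔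
      ∃ (T' : C) (e : T' ⟶ T) (_ : StrongEpi e) (x : T' ⟶ A.obj),
        Holds R (pair (e ≫ a') x) (e ≫ a) ∧ Holds f (pair x (e ≫ b)) (e ≫ b') := by
  rw [holds_whiskerRight_comp]
  constructor
  · rintro ⟨T', e, he, y, h, h'⟩
    obtain ⟨p, x, rfl⟩ := exists_pair y
    rw [holds_associator_hom_comp, comp_pair, holds_whiskerLeft] at h'
    rw [holds_dagger] at h
    obtain ⟨rfl, h'⟩ := h'
    exact ⟨T', e, he, x, h, h'⟩
  · rintro ⟨T', e, he, x, h, h'⟩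
    refine ⟨T', e, he, pair (e ≫ a') x, holds_dagger.2 h, ?_⟩
    rw [holds_associator_hom_comp, comp_pair, holds_whiskerLeft]
    exact ⟨rfl, h'⟩

/-- If R = g† ∘ g, then R(a, b) means that a and b have a common g-image on a cover. That condition
is symmetric in a and b, and the same image witnesses R(a, a). -/
theorem holds_of_isPositive {R : A ⟶ A} (hR : IsPositive R) {a b : T ⟶ A.obj}
    (h : Holds R a b) : Holds R b a ∧ Holds R a a := by
  obtain ⟨Y, g, rfl⟩ := hR
  obtain ⟨T', e, he, y, h₁, h₂⟩ := holds_comp.1 h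
  rw [holds_dagger] at h₂
  exact ⟨holds_comp.2 ⟨T', e, he, y, h₂, holds_dagger.2 h₁⟩,
    holds_comp.2 ⟨T', e, he, y, h₁, holds_dagger.2 h₁⟩⟩

/-- In a positively regular category, a symmetric relation that is reflexive on its domain is
positive. -/
theorem isPositive_of_holds (hC : IsPositivelyRegular C) {R : A ⟶ A}
    (hR : ∀ (T : C) (a b : T ⟶ A.obj), Holds R a b → Holds R b a ∧ Holds R a a) :
    IsPositive R := by
  -- P is {a | R(a, a)}. By hypothesis R relates only elements of P, so its restriction R' to P is
  -- reflexive and symmetric and loses nothing. A factorization of R' then gives one of R by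
  -- precomposing with the converse of the inclusion.
  let P : Subobject A.obj := (Subobject.pullback (diag A.obj)).obj (show Relation _ _ from R)
  let d : (P : C) ⟶ A.obj := P.arrow
  have hP : ∀ {T : C} (a : T ⟶ A.obj), Holds R a a → ∃ x : T ⟶ (P : C), x ≫ d = a := by
    intro T a ha
    have : P.Factors a := by
      rw [pullback_factors_iff]
      simpa [Holds, Relation.Holds, prod.comp_lift] using ha
    exact ⟨P.factorThru a this, P.factorThru_arrow a this⟩
  have hd : ∀ {T : C} (x : T ⟶ (P : C)), Holds R (x ≫ d) (x ≫ d) := by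
    intro T x
    have : P.Factors (x ≫ d) := Subobject.factors_comp_arrow x
    rw [pullback_factors_iff] at this
    simpa [Holds, Relation.Holds, prod.comp_lift] using this
  let R' : (⟨(P : C)⟩ : RelOf C) ⟶ ⟨(P : C)⟩ :=
    (Subobject.pullback (prod.map d d)).obj (show Relation _ _ from R)
  have hR' : ∀ {T : C} (x y : T ⟶ (P : C)), Holds R' x y ↔ Holds R (x ≫ d) (y ≫ d) := by
    intro T x y
    refine (pullback_factors_iff _ _ _).trans ?_
    rw [prod.lift_map]
    rfl
  obtain ⟨Y, g, hg⟩ := hC _ R' (by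
    refine (Subobject.isIso_arrow_iff_eq_top _).1 ?_
    have : Subobject.Factors ((Subobject.pullback (diag (P : C))).obj R') (𝟙 _) := by
      rw [pullback_factors_iff]
      have := (hR' (𝟙 _) (𝟙 _)).2 (hd _)
      simpa [Holds, Relation.Holds, diag] using this
    have : IsSplitEpi (Subobject.arrow ((Subobject.pullback (diag (P : C))).obj R')) :=
      IsSplitEpi.mk' ⟨Subobject.factorThru _ _ this, Subobject.factorThru_arrow _ _ this⟩
    exact isIso_of_mono_of_isSplitEpi _) (by
    refine Relation.ext_holds fun T x y => ?_
    rw [Relation.holds_converse_iff]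
    refine (hR' y x).trans (Iff.trans ?_ (hR' x y).symm)
    exact ⟨fun h => (hR _ _ _ h).1, fun h => (hR _ _ _ h).1⟩)
  let j : (⟨(P : C)⟩ : RelOf C) ⟶ A := Relation.graph d
  have hj : ∀ {T : C} (x : T ⟶ (P : C)) (a : T ⟶ A.obj), Holds j x a ↔ x ≫ d = a :=
    fun x a => Relation.holds_graph_iff
  refine ⟨Y, dagger j ≫ g, ?_⟩
  rw [dagger_comp, dagger_dagger, Category.assoc, ← Category.assoc g, ← hg]
  refine ext_holds fun T a b => ⟨fun h => ?_, fun h => ?_⟩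
  · obtain ⟨x, rfl⟩ := hP a (hR _ _ _ h).2
    obtain ⟨y, rfl⟩ := hP b (hR _ _ _ (hR _ _ _ h).1).2
    exact holds_comp_of (holds_dagger.2 ((hj _ _).2 rfl))
      (holds_comp_of ((hR' x y).2 h) ((hj _ _).2 rfl))
  · obtain ⟨T', e, he, x, h₁, h₂⟩ := holds_comp.1 h
    obtain ⟨T'', e', he', y, h₂, h₃⟩ := holds_comp.1 h₂
    rw [holds_dagger, hj] at h₁
    rw [hj] at h₃
    rw [hR', Category.assoc, h₁, h₃] at h₂
    exact (h₂.of_strongEpi e').of_strongEpi e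

end RelOf

theorem Relation.holds_mk_lift_iff {A B Y T : C} {f : Y ⟶ A} {g : Y ⟶ B}
    [Mono (prod.lift f g)] {a : T ⟶ A} {b : T ⟶ B} :
    Relation.Holds (Subobject.mk (prod.lift f g)) a b ↔ ∃ y : T ⟶ Y, y ≫ f = a ∧ y ≫ g = b := by
  refine (mk_factors_iff _ _).trans (exists_congr fun y => ?_)
  rw [prod.comp_lift]
  refine ⟨fun h => ⟨?_, ?_⟩, fun h => by rw [h.1, h.2]⟩
  · simpa [prod.lift_fst] using congrArg (· ≫ prod.fst) h
  · simpa [prod.lift_snd] using congrArg (· ≫ prod.snd) h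

/-! ### Element calculus in an internal groupoid -/

namespace InternalGroupoid
variable (G : InternalGroupoid C) {T : C}

/-- `G.Mul a b c`: the generalized elements `a`, `b` are composable and `a ∘ b = c`. -/
def Mul (a b c : T ⟶ G.C₁) : Prop :=
  ∃ h : a ≫ G.s = b ≫ G.t, pullback.lift a b h ≫ G.m = c

variable {G}

theorem Mul.precomp {a b c : T ⟶ G.C₁} (h : G.Mul a b c) {T' : C} (e : T' ⟶ T) :
    G.Mul (e ≫ a) (e ≫ b) (e ≫ c) := by
  obtain ⟨h, rfl⟩ := h
  refine ⟨by simp [h], Eq.trans ?_ (Category.assoc _ _ _)⟩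
  congr 1
  apply pullback.hom_ext <;> simp [pullback.lift_fst, pullback.lift_snd]

theorem Mul.unique {a b c c' : T ⟶ G.C₁} (h : G.Mul a b c) (h' : G.Mul a b c') : c = c' :=
  h.2.symm.trans h'.2

theorem exists_mul {a b : T ⟶ G.C₁} (h : a ≫ G.s = b ≫ G.t) : ∃ c, G.Mul a b c :=
  ⟨_, h, rfl⟩

theorem Mul.src {a b c : T ⟶ G.C₁} (h : G.Mul a b c) : c ≫ G.s = b ≫ G.s := by
  obtain ⟨h, rfl⟩ := h
  rw [Category.assoc, G.m_s, pullback.lift_snd_assoc]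

theorem Mul.tgt {a b c : T ⟶ G.C₁} (h : G.Mul a b c) : c ≫ G.t = a ≫ G.t := by
  obtain ⟨h, rfl⟩ := h
  rw [Category.assoc, G.m_t, pullback.lift_fst_assoc]

/-- The composability needed for `x` and `c` is part of the conclusion: the source of a composite is
the source of its right factor. -/
theorem Mul.assoc {a b c x y z : T ⟶ G.C₁} (h₁ : G.Mul a b x) (h₂ : G.Mul b c y)
    (h₃ : G.Mul a y z) : G.Mul x c z := by
  obtain ⟨h₁, rfl⟩ := h₁
  obtain ⟨h₂, rfl⟩ := h₂
  obtain ⟨h₃, rfl⟩ := h₃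
  exact ⟨_, G.assoc a b c h₁ h₂⟩

theorem Mul.assoc' {a b c x y z : T ⟶ G.C₁} (h₁ : G.Mul a b x) (h₂ : G.Mul b c y)
    (h₃ : G.Mul x c z) : G.Mul a y z := by
  obtain ⟨h₁, rfl⟩ := h₁
  obtain ⟨h₂, rfl⟩ := h₂
  obtain ⟨h₃, rfl⟩ := h₃
  exact ⟨_, (G.assoc a b c h₁ h₂).symm⟩

theorem mul_id (a : T ⟶ G.C₁) : G.Mul a (a ≫ G.s ≫ G.u) a := by
  simpa using Mul.precomp (G := G) ⟨_, G.comp_id⟩ a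

theorem id_mul (a : T ⟶ G.C₁) : G.Mul (a ≫ G.t ≫ G.u) a a := by
  simpa using Mul.precomp (G := G) ⟨_, G.id_comp⟩ a

theorem mul_inv (a : T ⟶ G.C₁) : G.Mul a (a ≫ G.i) (a ≫ G.t ≫ G.u) := by
  simpa using Mul.precomp (G := G) ⟨_, G.comp_inv⟩ a

theorem inv_mul (a : T ⟶ G.C₁) : G.Mul (a ≫ G.i) a (a ≫ G.s ≫ G.u) := by
  simpa using Mul.precomp (G := G) ⟨_, G.inv_comp⟩ a

theorem mul_u_iff {a b : T ⟶ G.C₁} {x : T ⟶ G.C₀} :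
    G.Mul a (x ≫ G.u) b ↔ a = b ∧ x = a ≫ G.s := by
  constructor
  · intro h
    have hx : x = a ≫ G.s := by simpa [G.u_t] using h.1.symm
    subst hx
    exact ⟨(mul_id a).unique (by simpa using h), rfl⟩
  · rintro ⟨rfl, rfl⟩
    simpa using mul_id a

theorem u_mul_iff {a b : T ⟶ G.C₁} {x : T ⟶ G.C₀} :
    G.Mul (x ≫ G.u) a b ↔ a = b ∧ x = a ≫ G.t := by
  constructor
  · intro h
    have hx : x = a ≫ G.t := by simpa [G.u_s] using h.1
    subst hx
    exact ⟨(id_mul a).unique (by simpa using h), rfl⟩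
  · rintro ⟨rfl, rfl⟩
    simpa using id_mul a

theorem Mul.inv_left {a b c : T ⟶ G.C₁} (h : G.Mul a b c) : G.Mul (a ≫ G.i) c b := by
  refine Mul.assoc' (inv_mul a) h ?_
  have := id_mul b
  rwa [← Category.assoc b, ← h.1, Category.assoc] at this

theorem Mul.inv_right {a b c : T ⟶ G.C₁} (h : G.Mul a b c) : G.Mul c (b ≫ G.i) a := by
  refine Mul.assoc h (mul_inv b) ?_
  have := mul_id a
  rwa [← Category.assoc a, h.1, Category.assoc] at this

theorem Mul.left_cancel {a b b' c : T ⟶ G.C₁} (h : G.Mul a b c) (h' : G.Mul a b' c) : b = b' :=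
  h.inv_left.unique h'.inv_left

theorem Mul.right_cancel {a a' b c : T ⟶ G.C₁} (h : G.Mul a b c) (h' : G.Mul a' b c) : a = a' :=
  h.inv_right.unique h'.inv_right

theorem inv_inv (a : T ⟶ G.C₁) : (a ≫ G.i) ≫ G.i = a := by
  have h := mul_inv (a ≫ G.i)
  rw [← Category.assoc _ G.t, Category.assoc a G.i G.t, G.i_t, Category.assoc a G.s] at h
  exact h.left_cancel (inv_mul a)

theorem inv_src (a : T ⟶ G.C₁) : (a ≫ G.i) ≫ G.s = a ≫ G.t := by
  rw [Category.assoc, G.i_s]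

/-! ### From groupoids to Frobenius structures -/

variable (G)

instance mono_mulGraph :
    Mono (prod.lift (prod.lift (pullback.fst G.s G.t) (pullback.snd G.s G.t)) G.m) := by
  refine ⟨fun x y h => ?_⟩
  have h := congrArg (· ≫ prod.fst) h
  simp only [Category.assoc, prod.lift_fst] at h
  refine pullback.hom_ext ?_ ?_
  · simpa [prod.lift_fst] using congrArg (· ≫ prod.fst) h
  · simpa [prod.lift_snd] using congrArg (· ≫ prod.snd) h

instance mono_oneGraph : Mono (prod.lift (terminal.from G.C₀) G.u) := by
  refine ⟨fun x y h => ?_⟩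
  have h := congrArg (· ≫ prod.snd ≫ G.s) h
  simpa [prod.lift_snd_assoc, G.u_s] using h

/-- The object of morphisms of an internal groupoid, as an object of `Rel(C)`. -/
abbrev relOf : RelOf C := ⟨G.C₁⟩

/-- The composition of an internal groupoid, as a relation. -/
noncomputable def mulRel : G.relOf ⊗ G.relOf ⟶ G.relOf :=
  (Subobject.mk (prod.lift (prod.lift (pullback.fst G.s G.t) (pullback.snd G.s G.t)) G.m) :
    Relation (G.C₁ ⨯ G.C₁) G.C₁)

/-- The identities of an internal groupoid, as a relation. -/
noncomputable def oneRel : 𝟙_ (RelOf C) ⟶ G.relOf :=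
  (Subobject.mk (prod.lift (terminal.from G.C₀) G.u) : Relation (⊤_ C) G.C₁)

variable {G}

theorem holds_mulRel {a b c : T ⟶ G.C₁} :
    RelOf.Holds G.mulRel (RelOf.pair a b) c ↔ G.Mul a b c := by
  refine Relation.holds_mk_lift_iff.trans ?_
  constructor
  · rintro ⟨g, h, rfl⟩
    have h' := RelOf.pair_inj.1 ((prod.comp_lift _ _ _).symm.trans h)
    obtain rfl : g ≫ pullback.fst G.s G.t = a := h'.1
    obtain rfl : g ≫ pullback.snd G.s G.t = b := h'.2
    refine ⟨by simp [pullback.condition], ?_⟩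
    congr 1
    apply pullback.hom_ext <;> simp [pullback.lift_fst, pullback.lift_snd]
  · rintro ⟨h, rfl⟩
    refine ⟨pullback.lift a b h, ?_, rfl⟩
    rw [prod.comp_lift, pullback.lift_fst, pullback.lift_snd]
    rfl

theorem holds_oneRel {x : T ⟶ (𝟙_ (RelOf C)).obj} {a : T ⟶ G.C₁} :
    RelOf.Holds G.oneRel x a ↔ ∃ y, y ≫ G.u = a := by
  refine (Relation.holds_mk_lift_iff (A := ⊤_ C)).trans ⟨fun ⟨g, _, h⟩ => ⟨g, h⟩, fun ⟨y, h⟩ => ⟨y, ?_, h⟩⟩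
  exact Subsingleton.elim (α := T ⟶ ⊤_ C) _ _

open RelOf

variable (G)

/-- Both sides relate (a, b) to (c, d) when ab = cd. The left side asks for x with cx = a and xb =
d; given ab = cd, the element x = c⁻¹a works. -/
theorem dagger_mulRel_whiskerRight :
    dagger G.mulRel ▷ G.relOf ≫ (α_ G.relOf G.relOf G.relOf).hom ≫ G.relOf ◁ G.mulRel =
      G.mulRel ≫ dagger G.mulRel := by
  refine ext_pair fun T a b x => ?_
  obtain ⟨c, d, rfl⟩ := exists_pair x
  rw [holds_dagger_whiskerRight_comp, holds_comp]
  simp only [comp_pair, holds_dagger, holds_mulRel]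
  constructor
  · rintro ⟨T', e, he, x, h₁, h₂⟩
    obtain ⟨z, hz⟩ := exists_mul (G := G) (a := e ≫ a) (b := e ≫ b) (by rw [h₁.src, h₂.1])
    exact ⟨T', e, he, z, hz, Mul.assoc' h₁ h₂ hz⟩
  · rintro ⟨T', e, he, z, h₁, h₂⟩
    obtain ⟨x, hx⟩ := exists_mul (G := G) (a := (e ≫ c) ≫ G.i) (b := e ≫ a)
      (by rw [inv_src, ← h₁.tgt, ← h₂.tgt])
    have hx' := hx.inv_left
    rw [inv_inv] at hx'
    exact ⟨T', e, he, x, hx', Mul.assoc hx h₁ h₂.inv_left⟩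

/-- The left side equals μ† ∘ μ, which is its own dagger, and the right side is the dagger of the
left. -/
theorem isFrobenius_mulRel :
    dagger G.mulRel ▷ G.relOf ≫ (α_ G.relOf G.relOf G.relOf).hom ≫ G.relOf ◁ G.mulRel =
      G.relOf ◁ dagger G.mulRel ≫ (α_ G.relOf G.relOf G.relOf).inv ≫ G.mulRel ▷ G.relOf := by
  rw [dagger_mulRel_whiskerRight]
  have h := congrArg dagger G.dagger_mulRel_whiskerRight
  simp only [dagger_comp, dagger_dagger, dagger_whiskerLeft, dagger_whiskerRight,
    dagger_associator_hom, Category.assoc] at h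
  exact h.symm

/-- The special dagger Frobenius structure of an internal groupoid. -/
noncomputable def frob : SpecialDaggerFrobenius (RelOf C) where
  X := G.relOf
  mul := G.mulRel
  one := G.oneRel
  one_mul := by
    refine ext_pair fun T x a b => ?_
    rw [holds_whiskerRight_comp, holds_leftUnitor_hom]
    simp only [holds_mulRel, holds_oneRel]
    constructor
    · rintro ⟨T', e, he, _, ⟨y, rfl⟩, h⟩
      exact (cancel_epi e).1 (u_mul_iff.1 h).1
    · rintro rfl
      exact ⟨T, 𝟙 T, inferInstance, _, ⟨a ≫ G.t, rfl⟩, u_mul_iff.2 ⟨rfl, by simp⟩⟩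
  mul_one := by
    refine ext_pair fun T a x b => ?_
    rw [holds_whiskerLeft_comp, holds_rightUnitor_hom]
    simp only [holds_mulRel, holds_oneRel]
    constructor
    · rintro ⟨T', e, he, _, ⟨y, rfl⟩, h⟩
      exact (cancel_epi e).1 (mul_u_iff.1 h).1
    · rintro rfl
      exact ⟨T, 𝟙 T, inferInstance, _, ⟨a ≫ G.s, rfl⟩, mul_u_iff.2 ⟨rfl, by simp⟩⟩
  mul_assoc := by
    refine ext_pair fun T x c d => ?_
    obtain ⟨a, b, rfl⟩ := exists_pair x
    rw [holds_whiskerRight_comp, holds_associator_hom_comp, holds_whiskerLeft_comp]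
    simp only [comp_pair, holds_mulRel]
    constructor
    · rintro ⟨T', e, he, x, h₁, h₂⟩
      obtain ⟨y, hy⟩ := exists_mul (h₁.src.symm.trans h₂.1)
      exact ⟨T', e, he, y, hy, h₁.assoc' hy h₂⟩
    · rintro ⟨T', e, he, y, h₁, h₂⟩
      obtain ⟨x, hx⟩ := exists_mul (h₂.1.trans h₁.tgt)
      exact ⟨T', e, he, x, hx, hx.assoc h₁ h₂⟩
  special := by
    refine ext_holds fun T a b => ?_
    rw [holds_comp, holds_id]
    constructor
    · rintro ⟨T', e, he, x, h₁, h₂⟩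
      obtain ⟨p, q, rfl⟩ := exists_pair x
      rw [holds_dagger, holds_mulRel] at h₁
      rw [holds_mulRel] at h₂
      exact (cancel_epi e).1 (h₁.unique h₂)
    · rintro rfl
      refine ⟨T, 𝟙 T, inferInstance, pair a (a ≫ G.s ≫ G.u), ?_, ?_⟩
      · rw [holds_dagger, holds_mulRel, Category.id_comp]
        exact mul_id a
      · rw [holds_mulRel, Category.id_comp]
        exact mul_id a
  frobenius := G.isFrobenius_mulRel

/-! ### Complete positivity and inverses -/

variable {G} {H : InternalGroupoid C}

/-- The equations force x = a'⁻¹a and y = b'b⁻¹, so an entry of the Choi matrix is a value of `R`.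
-/
theorem holds_choi_frob {R : G.frob.X ⟶ H.frob.X} {a a' : T ⟶ G.C₁} {b b' : T ⟶ H.C₁} :
    Holds (choi G.frob H.frob R) (pair a b) (pair a' b') ↔
      ∃ (T' : C) (e : T' ⟶ T) (_ : StrongEpi e) (x : T' ⟶ G.C₁) (y : T' ⟶ H.C₁),
        G.Mul (e ≫ a') x (e ≫ a) ∧ Holds R x y ∧ H.Mul y (e ≫ b) (e ≫ b') := by
  unfold choi
  rw [← MonoidalCategory.whiskerLeft_comp]
  refine holds_dagger_whiskerRight_comp.trans ⟨?_, ?_⟩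
  · rintro ⟨T', e, he, x, h₁, h₂⟩
    obtain ⟨T'', e', he', y, h₂, h₃⟩ := holds_whiskerRight_comp.1 h₂
    refine ⟨T'', e' ≫ e, strongEpi_comp _ _, e' ≫ x, y, ?_, h₂, ?_⟩
    · rw [Category.assoc, Category.assoc]
      exact (holds_mulRel.1 h₁).precomp e'
    · rw [Category.assoc, Category.assoc]
      exact holds_mulRel.1 h₃
  · rintro ⟨T', e, he, x, y, h₁, h₂, h₃⟩
    exact ⟨T', e, he, x, holds_mulRel.2 h₁,
      holds_comp_of (holds_whiskerRight.2 ⟨h₂, rfl⟩) (holds_mulRel.2 h₃)⟩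

theorem holds_choi_frob_of {R : G.frob.X ⟶ H.frob.X} {a a' x : T ⟶ G.C₁} {b b' y : T ⟶ H.C₁}
    (h₁ : G.Mul a' x a) (h₂ : Holds R x y) (h₃ : H.Mul y b b') :
    Holds (choi G.frob H.frob R) (pair a b) (pair a' b') :=
  holds_choi_frob.2 ⟨T, 𝟙 T, inferInstance, x, y, by rwa [Category.id_comp, Category.id_comp], h₂,
    by rwa [Category.id_comp, Category.id_comp]⟩

end InternalGroupoid

open RelOf InternalGroupoid

variable {G H : InternalGroupoid C} {R : Relation G.C₁ H.C₁}

/-- The value R(a, b) is the entry of the Choi matrix from (a, id_{dom b}) to (id_{cod a}, b). Its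
transposed entry is R(a⁻¹, b⁻¹), and the diagonal entry at (a, id_{dom b}) is R(id_{dom a}, id_{dom
b}); positivity yields both. -/
theorem respectsInverses_of_isCompletelyPositive
    (hR : IsCompletelyPositive G.frob H.frob R) : RespectsInverses G H R := by
  rw [respectsInverses_iff]
  intro T a b hab
  have h : Holds (choi G.frob H.frob R) (pair a (b ≫ H.s ≫ H.u)) (pair (a ≫ G.t ≫ G.u) b) :=
    holds_choi_frob_of (id_mul a) hab (mul_id b)
  obtain ⟨h₁, h₂⟩ := holds_of_isPositive hR h
  constructor
  · obtain ⟨T', e, he, x, y, hx, hxy, hy⟩ := holds_choi_frob.1 h₁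
    have hx := hx.left_cancel (c := e ≫ a ≫ G.t ≫ G.u) (by simpa using (mul_inv a).precomp e)
    have hy := hy.right_cancel (c := e ≫ b ≫ H.s ≫ H.u) (by simpa using (inv_mul b).precomp e)
    subst hx hy
    exact Relation.Holds.of_strongEpi e hxy
  · obtain ⟨T', e, he, x, y, hx, hxy, hy⟩ := holds_choi_frob.1 h₂
    have hx := hx.left_cancel (by simpa using (mul_id a).precomp e)
    have hu : H.Mul (b ≫ H.s ≫ H.u) (b ≫ H.s ≫ H.u) (b ≫ H.s ≫ H.u) := by
      simpa [H.u_t] using (u_mul_iff (x := b ≫ H.s) (a := b ≫ H.s ≫ H.u)).2 ⟨rfl, by simp [H.u_t]⟩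
    have hy := hy.right_cancel (hu.precomp e)
    subst hx hy
    exact Relation.Holds.of_strongEpi e hxy

/-- If (x, y) witnesses an entry of the Choi matrix, then (x⁻¹, y⁻¹) witnesses the transposed entry
and (id_{dom x}, id_{dom y}) the diagonal one. -/
theorem RespectsInverses.isCompletelyPositive (hC : IsPositivelyRegular C)
    (hR : RespectsInverses G H R) : IsCompletelyPositive G.frob H.frob R := by
  rw [respectsInverses_iff] at hR
  refine isPositive_of_holds hC fun T p q h => ?_
  obtain ⟨a, b, rfl⟩ := exists_pair p
  obtain ⟨a', b', rfl⟩ := exists_pair q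
  obtain ⟨T', e, he, x, y, hx, hxy, hy⟩ := holds_choi_frob.1 h
  obtain ⟨h₁, h₂⟩ := hR _ _ _ hxy
  refine ⟨holds_choi_frob.2 ⟨T', e, he, _, _, hx.inv_right, h₁, hy.inv_left⟩,
    holds_choi_frob.2 ⟨T', e, he, _, _, ?_, h₂, ?_⟩⟩
  · have := mul_id (e ≫ a)
    rwa [← Category.assoc _ G.s, hx.src, Category.assoc] at this
  · have := id_mul (e ≫ b)
    rwa [← Category.assoc _ H.t, ← hy.1, Category.assoc] at this

/-- The functor sending a groupoid to its special dagger Frobenius structure. -/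
noncomputable def GpdRel.toCP (hC : IsPositivelyRegular C) : GpdRel C ⥤ CP (RelOf C) where
  obj G := ⟨G.gpd.frob⟩
  map f := ⟨f.rel, f.respectsInverses.isCompletelyPositive hC⟩

/-- Completely positive relations between groupoids are relations respecting inverses. -/
def GpdRel.fullyFaithfulToCP (hC : IsPositivelyRegular C) : (GpdRel.toCP hC).FullyFaithful where
  preimage f := ⟨f.hom, respectsInverses_of_isCompletelyPositive f.isCompletelyPositive⟩

/-! ### From Frobenius structures to groupoids -/

namespace RelFrobenius
open RelOf
variable {A : SpecialDaggerFrobenius (RelOf C)} {T : C}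

variable (A) in
/-- `Mul A a b c`: the multiplication of `A` relates `(a, b)` to `c`. -/
def Mul (a b c : T ⟶ A.X.obj) : Prop :=
  Holds A.mul (pair a b) c

variable (A) in
/-- `IsUnit A u`: the generalized element `u` belongs to the unit of `A`. -/
def IsUnit (u : T ⟶ A.X.obj) : Prop :=
  Holds A.one (terminal.from T) u

theorem Mul.precomp {a b c : T ⟶ A.X.obj} (h : Mul A a b c) {T' : C} (e : T' ⟶ T) :
    Mul A (e ≫ a) (e ≫ b) (e ≫ c) := by
  simpa [Mul] using Holds.precomp h e

theorem Mul.of_strongEpi {a b c : T ⟶ A.X.obj} {T' : C} (e : T' ⟶ T) [StrongEpi e]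
    (h : Mul A (e ≫ a) (e ≫ b) (e ≫ c)) : Mul A a b c :=
  Holds.of_strongEpi e (by rwa [comp_pair])

theorem isUnit_of_holds {u : T ⟶ A.X.obj} {x : T ⟶ (𝟙_ (RelOf C)).obj} (h : Holds A.one x u) :
    IsUnit A u := by
  rwa [Subsingleton.elim (α := T ⟶ ⊤_ C) x (terminal.from T)] at h

theorem IsUnit.precomp {u : T ⟶ A.X.obj} (h : IsUnit A u) {T' : C} (e : T' ⟶ T) :
    IsUnit A (e ≫ u) :=
  isUnit_of_holds (Holds.precomp h e)

theorem IsUnit.of_strongEpi {u : T ⟶ A.X.obj} {T' : C} (e : T' ⟶ T) [StrongEpi e]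
    (h : IsUnit A (e ≫ u)) : IsUnit A u := by
  refine Holds.of_strongEpi e ?_
  rwa [Subsingleton.elim (α := T' ⟶ ⊤_ C) (e ≫ terminal.from T) (terminal.from T')]

/-- This is the special law: c and c' are related by μ ∘ μ† = id through the pair (a, b). -/
theorem Mul.unique {a b c c' : T ⟶ A.X.obj} (h : Mul A a b c) (h' : Mul A a b c') : c = c' := by
  have := holds_comp_of (holds_dagger.2 h) h'
  rwa [A.special, holds_id] at this

/-- Products exist as soon as they exist locally. -/
theorem exists_mul_of_strongEpi {a b : T ⟶ A.X.obj} {T' : C} (e : T' ⟶ T) [StrongEpi e]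
    {c : T' ⟶ A.X.obj} (h : Mul A (e ≫ a) (e ≫ b) c) : ∃ d, e ≫ d = c ∧ Mul A a b d := by
  obtain ⟨d, rfl⟩ := exists_desc_of_strongEpi e c fun S p q hpq => by
    have h₁ := h.precomp p
    have h₂ := h.precomp q
    simp only [← Category.assoc, hpq] at h₁ h₂
    exact h₁.unique h₂
  exact ⟨d, rfl, h.of_strongEpi e⟩

/-- Equality of the two bracketings as relations gives ab only on a cover; products are unique, so
it descends. -/
theorem Mul.assoc {a b c y z : T ⟶ A.X.obj} (h₁ : Mul A b c y) (h₂ : Mul A a y z) :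
    ∃ x, Mul A a b x ∧ Mul A x c z := by
  have h : Holds ((α_ A.X A.X A.X).hom ≫ A.X ◁ A.mul ≫ A.mul) (pair (pair a b) c) z := by
    rw [holds_associator_hom_comp]
    exact holds_comp_of (holds_whiskerLeft.2 ⟨rfl, h₁⟩) h₂
  rw [← A.mul_assoc, holds_whiskerRight_comp] at h
  obtain ⟨T', e, he, x, h₁, h₂⟩ := h
  rw [comp_pair] at h₁
  obtain ⟨x, rfl, h⟩ := exists_mul_of_strongEpi e h₁
  exact ⟨x, h, Mul.of_strongEpi e h₂⟩

theorem Mul.assoc' {a b c x z : T ⟶ A.X.obj} (h₁ : Mul A a b x) (h₂ : Mul A x c z) :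
    ∃ y, Mul A b c y ∧ Mul A a y z := by
  have h : Holds (A.mul ▷ A.X ≫ A.mul) (pair (pair a b) c) z :=
    holds_comp_of (holds_whiskerRight.2 ⟨h₁, rfl⟩) h₂
  rw [A.mul_assoc, holds_associator_hom_comp, holds_whiskerLeft_comp] at h
  obtain ⟨T', e, he, y, h₁, h₂⟩ := h
  rw [comp_pair] at h₁
  obtain ⟨y, rfl, h⟩ := exists_mul_of_strongEpi e h₁
  exact ⟨y, h, Mul.of_strongEpi e h₂⟩

theorem IsUnit.eq_of_mul_left {u a b : T ⟶ A.X.obj} (hu : IsUnit A u) (h : Mul A u a b) :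
    a = b := by
  have := holds_comp_of (holds_whiskerRight.2 ⟨hu, rfl⟩) h
  rwa [A.one_mul, holds_leftUnitor_hom] at this

theorem IsUnit.eq_of_mul_right {u a b : T ⟶ A.X.obj} (hu : IsUnit A u) (h : Mul A a u b) :
    a = b := by
  have := holds_comp_of (holds_whiskerLeft.2 ⟨rfl, hu⟩) h
  rwa [A.mul_one, holds_rightUnitor_hom] at this

/-- From u(va) = a the product uv exists, and since both factors are units it equals u and v. -/
theorem IsUnit.unique_left {u v a : T ⟶ A.X.obj} (hu : IsUnit A u) (hv : IsUnit A v)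
    (h : Mul A u a a) (h' : Mul A v a a) : u = v := by
  obtain ⟨x, hx, -⟩ := h'.assoc h
  exact (hv.eq_of_mul_right hx).trans (hu.eq_of_mul_left hx).symm

theorem IsUnit.unique_right {u v a : T ⟶ A.X.obj} (hu : IsUnit A u) (hv : IsUnit A v)
    (h : Mul A a u a) (h' : Mul A a v a) : u = v := by
  obtain ⟨x, hx, -⟩ := h.assoc' h'
  exact (hv.eq_of_mul_right hx).trans (hu.eq_of_mul_left hx).symm

theorem exists_left_unit (a : T ⟶ A.X.obj) : ∃ u, IsUnit A u ∧ Mul A u a a := by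
  have h : Holds (A.one ▷ A.X ≫ A.mul) (pair (A := 𝟙_ (RelOf C)) (terminal.from T) a) a := by
    rw [A.one_mul, holds_leftUnitor_hom]
  obtain ⟨T', e, he, u, hu, h⟩ := holds_whiskerRight_comp.1 h
  have hu := isUnit_of_holds hu
  obtain ⟨u, rfl⟩ := exists_desc_of_strongEpi e u fun S p q hpq => by
    have h₁ := Mul.precomp h p
    have h₂ := Mul.precomp h q
    simp only [← Category.assoc, hpq] at h₁ h₂
    exact (hu.precomp p).unique_left (hu.precomp q) h₁ h₂
  exact ⟨u, hu.of_strongEpi e, Mul.of_strongEpi e h⟩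

theorem exists_right_unit (a : T ⟶ A.X.obj) : ∃ u, IsUnit A u ∧ Mul A a u a := by
  have h : Holds (A.X ◁ A.one ≫ A.mul) (pair (B := 𝟙_ (RelOf C)) a (terminal.from T)) a := by
    rw [A.mul_one, holds_rightUnitor_hom]
  obtain ⟨T', e, he, u, hu, h⟩ := holds_whiskerLeft_comp.1 h
  have hu := isUnit_of_holds hu
  obtain ⟨u, rfl⟩ := exists_desc_of_strongEpi e u fun S p q hpq => by
    have h₁ := Mul.precomp h p
    have h₂ := Mul.precomp h q
    simp only [← Category.assoc, hpq] at h₁ h₂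
    exact (hu.precomp p).unique_right (hu.precomp q) h₁ h₂
  exact ⟨u, hu.of_strongEpi e, Mul.of_strongEpi e h⟩

theorem IsUnit.mul_self {u : T ⟶ A.X.obj} (hu : IsUnit A u) : Mul A u u u := by
  obtain ⟨v, -, h⟩ := exists_left_unit u
  obtain rfl := hu.eq_of_mul_right h
  exact h

/-- Since (au)b is defined, so is ub, and a unit can only fix b. -/
theorem IsUnit.mul_left {u a b c : T ⟶ A.X.obj} (hu : IsUnit A u) (h : Mul A a u a)
    (h' : Mul A a b c) : Mul A u b b := by
  obtain ⟨y, hy, -⟩ := h.assoc' h'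
  rwa [← hu.eq_of_mul_left hy] at hy

theorem IsUnit.mul_right {u a b c : T ⟶ A.X.obj} (hu : IsUnit A u) (h : Mul A u b b)
    (h' : Mul A a b c) : Mul A a u a := by
  obtain ⟨x, hx, -⟩ := h.assoc h'
  rwa [← hu.eq_of_mul_right hx] at hx

/-- From ua = a = av, the relation μ† ∘ μ links (u, a) to (a, v). Rewritten by the Frobenius law as
(1 ⊗ μ) ∘ (μ† ⊗ 1), this link is an f with af = u and fa = v. -/
theorem exists_inverse {a u v : T ⟶ A.X.obj} (hu : IsUnit A u) (hv : IsUnit A v)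
    (h : Mul A u a a) (h' : Mul A a v a) : ∃ f, Mul A a f u ∧ Mul A f a v := by
  have key : Holds (A.mul ≫ dagger A.mul) (pair u a) (pair a v) :=
    holds_comp_of h (holds_dagger.2 h')
  rw [A.mul_comp_dagger_mul, holds_dagger_whiskerRight_comp] at key
  obtain ⟨T', e, he, f, h₁, h₂⟩ := key
  have h₁ : Mul A (e ≫ a) f (e ≫ u) := h₁
  have h₂ : Mul A f (e ≫ a) (e ≫ v) := h₂
  -- Two inverses f and f' agree: f = fu = f(af') = (fa)f' = vf' = f'.
  obtain ⟨f, rfl⟩ := exists_desc_of_strongEpi e f fun S p q hpq => by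
    have k₁ := (hv.precomp e).mul_left (h'.precomp e) h₁
    have k₂ := (hu.precomp e).mul_right (h.precomp e) h₂
    have k₁ := k₁.precomp q
    have k₂ := k₂.precomp p
    have h₁ := h₁.precomp q
    have h₂ := h₂.precomp p
    simp only [← Category.assoc, ← hpq] at h₁ h₂ k₁ k₂
    obtain ⟨y, hy, hy'⟩ := h₂.assoc' k₁
    obtain rfl := hy.unique h₁
    exact k₂.unique hy'
  exact ⟨f, Mul.of_strongEpi e h₁, Mul.of_strongEpi e h₂⟩

/-- Take f with fa = u. Then (fa)b = ub = b is defined, so associativity makes ab defined. -/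
theorem exists_mul {a b u : T ⟶ A.X.obj} (hu : IsUnit A u) (h : Mul A a u a)
    (h' : Mul A u b b) : ∃ c, Mul A a b c := by
  obtain ⟨v, hv, hva⟩ := exists_left_unit a
  obtain ⟨f, -, hf⟩ := exists_inverse hv hu hva h
  obtain ⟨c, hc, -⟩ := hf.assoc' h'
  exact ⟨c, hc⟩

variable (A) in
/-- The units of `A` form a subobject. -/
theorem exists_unit_object : ∃ (X₀ : C) (u : X₀ ⟶ A.X.obj), Mono u ∧
    ∀ (T : C) (a : T ⟶ A.X.obj), IsUnit A a ↔ ∃ x : T ⟶ X₀, x ≫ u = a := by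
  let P : Subobject ((⊤_ C) ⨯ A.X.obj) := A.one
  refine ⟨(P : C), P.arrow ≫ prod.snd, ⟨fun x y h => ?_⟩, fun T a => ⟨fun h => ?_, ?_⟩⟩
  · refine (cancel_mono P.arrow).1 (Limits.prod.hom_ext (Subsingleton.elim _ _) ?_)
    simpa using h
  · have h : P.Factors (prod.lift (terminal.from T) a) := h
    exact ⟨P.factorThru _ h, by rw [Subobject.factorThru_arrow_assoc]; exact prod.lift_snd _ _⟩
  · rintro ⟨x, rfl⟩
    have : P.Factors (prod.lift (terminal.from T) (x ≫ P.arrow ≫ prod.snd)) := by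
      have h : prod.lift (terminal.from T) (x ≫ P.arrow ≫ prod.snd) = x ≫ P.arrow :=
        Limits.prod.hom_ext (Subsingleton.elim _ _) (by simp [prod.lift_snd])
      rw [h]
      exact Subobject.factors_comp_arrow x
    exact this

/-- The remaining fields are propositions. The groupoid is built on the very object `A.X`, so
equality is available, not just isomorphism. -/
theorem ext_of_heq {A B : SpecialDaggerFrobenius (RelOf C)} (hX : A.X = B.X)
    (hmul : HEq A.mul B.mul) (hone : HEq A.one B.one) : A = B := by
  cases A
  cases B
  cases hX
  cases hmul
  cases hone
  rfl

variable (A) in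
/-- Every special dagger Frobenius structure in `Rel(C)` is that of an internal groupoid. -/
theorem exists_groupoid : ∃ G : InternalGroupoid C, G.frob = A := by
  obtain ⟨X₀, u, _, hu⟩ := exists_unit_object A
  have hux {T : C} (x : T ⟶ X₀) : IsUnit A (x ≫ u) := (hu _ _).2 ⟨x, rfl⟩
  -- The unit of the universal element 𝟙 is target (here) or source (next) as a morphism;
  -- precomposition gives it for every element.
  obtain ⟨t, ht⟩ : ∃ t : A.X.obj ⟶ X₀, Mul A (t ≫ u) (𝟙 _) (𝟙 _) := by
    obtain ⟨v, hv, h⟩ := exists_left_unit (𝟙 A.X.obj)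
    obtain ⟨t, rfl⟩ := (hu _ _).1 hv
    exact ⟨t, h⟩
  obtain ⟨s, hs⟩ : ∃ s : A.X.obj ⟶ X₀, Mul A (𝟙 _) (s ≫ u) (𝟙 _) := by
    obtain ⟨v, hv, h⟩ := exists_right_unit (𝟙 A.X.obj)
    obtain ⟨s, rfl⟩ := (hu _ _).1 hv
    exact ⟨s, h⟩
  have ht' {T : C} (a : T ⟶ A.X.obj) : Mul A ((a ≫ t) ≫ u) a a := by simpa using ht.precomp a
  have hs' {T : C} (a : T ⟶ A.X.obj) : Mul A a ((a ≫ s) ≫ u) a := by simpa using hs.precomp a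
  have eq_t {T : C} {x : T ⟶ X₀} {a : T ⟶ A.X.obj} (h : Mul A (x ≫ u) a a) : a ≫ t = x :=
    (cancel_mono u).1 ((hux _).unique_left (hux _) (ht' a) h)
  have eq_s {T : C} {x : T ⟶ X₀} {a : T ⟶ A.X.obj} (h : Mul A a (x ≫ u) a) : a ≫ s = x :=
    (cancel_mono u).1 ((hux _).unique_right (hux _) (hs' a) h)
  -- With c = ab, associativity turns a(b · s(b)) = c into c · s(b) = c; right units are unique.
  have comp_s {T : C} {a b c : T ⟶ A.X.obj} (h : Mul A a b c) : c ≫ s = b ≫ s := by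
    obtain ⟨x, hx, hx'⟩ := (hs' b).assoc h
    obtain rfl := hx.unique h
    exact eq_s hx'
  have comp_t {T : C} {a b c : T ⟶ A.X.obj} (h : Mul A a b c) : c ≫ t = a ≫ t := by
    obtain ⟨x, hx, hx'⟩ := (ht' a).assoc' h
    obtain rfl := hx.unique h
    exact eq_t hx'
  have comp_eq {T : C} {a b c : T ⟶ A.X.obj} (h : Mul A a b c) : a ≫ s = b ≫ t :=
    (eq_t ((hux _).mul_left (hs' a) h)).symm
  obtain ⟨i, hi, hi'⟩ := exists_inverse (hux t) (hux s) ht hs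
  -- Composition is the product of the universal composable pair.
  obtain ⟨m, hm⟩ := exists_mul (hux _) (hs' (pullback.fst s t))
    (by rw [pullback.condition]; exact ht' (pullback.snd s t))
  have hm' {T : C} {a b : T ⟶ A.X.obj} (h : a ≫ s = b ≫ t) :
      Mul A a b (pullback.lift a b h ≫ m) := by
    simpa [pullback.lift_fst, pullback.lift_snd] using hm.precomp (pullback.lift a b h)
  have hi_s : i ≫ s = t := by
    have := comp_s hi
    rw [← this, Category.assoc]
    have h : u ≫ s = 𝟙 X₀ := eq_s (by simpa using (hux (𝟙 X₀)).mul_self)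
    rw [h, Category.comp_id]
  have hi_t : i ≫ t = s := by
    have := comp_t hi'
    rw [← this, Category.assoc]
    have h : u ≫ t = 𝟙 X₀ := eq_t (by simpa using (hux (𝟙 X₀)).mul_self)
    rw [h, Category.comp_id]
  let G : InternalGroupoid C :=
    { C₀ := X₀
      C₁ := A.X.obj
      s := s
      t := t
      u := u
      m := m
      i := i
      u_s := eq_s (by simpa using (hux (𝟙 X₀)).mul_self)
      u_t := eq_t (by simpa using (hux (𝟙 X₀)).mul_self)
      m_s := comp_s hm
      m_t := comp_t hm
      comp_id := (hm' _).unique hs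
      id_comp := (hm' _).unique ht
      assoc := fun a b c hab hbc => by
        obtain ⟨y, hy, hy'⟩ := (hm' hab).assoc' (hm' _)
        obtain rfl := hy.unique (hm' hbc)
        exact hy'.unique (hm' _)
      i_s := hi_s
      i_t := hi_t
      comp_inv := (hm' _).unique hi
      inv_comp := (hm' _).unique hi' }
  refine ⟨G, ext_of_heq rfl (heq_of_eq ?_) (heq_of_eq ?_)⟩
  · refine ext_pair (A := A.X) (B := A.X) (D := A.X) fun T a b c => ?_
    refine (InternalGroupoid.holds_mulRel (G := G)).trans ⟨?_, fun h => ?_⟩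
    · rintro ⟨h, rfl⟩
      exact hm' h
    · exact ⟨comp_eq h, (hm' _).unique h⟩
  · refine ext_holds (B := A.X) fun T x a => ?_
    refine (InternalGroupoid.holds_oneRel (G := G)).trans ((hu T a).symm.trans ?_)
    rw [Subsingleton.elim (α := T ⟶ ⊤_ C) x (terminal.from T)]
    rfl

end RelFrobenius

/-! ### The equivalence -/

theorem GpdRel.essSurj_toCP (hC : IsPositivelyRegular C) : (GpdRel.toCP hC).EssSurj where
  mem_essImage A := by
    obtain ⟨G, hG⟩ := RelFrobenius.exists_groupoid A.frob
    exact ⟨⟨G⟩, ⟨eqToIso (congrArg CP.mk hG)⟩⟩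

end

end InternalRel

theorem mainTheorem6 {C : Type u} [Category.{v} C] [Regular C]
    (hC : InternalRel.IsPositivelyRegular C) :
    Nonempty (CP (InternalRel.RelOf C) ≌ InternalRel.GpdRel C) := by
  have := InternalRel.GpdRel.essSurj_toCP hC
  have := (InternalRel.GpdRel.fullyFaithfulToCP hC).full
  have := (InternalRel.GpdRel.fullyFaithfulToCP hC).faithful
  have : (InternalRel.GpdRel.toCP hC).IsEquivalence := {}
  exact ⟨(InternalRel.GpdRel.toCP hC).asEquivalence.symm⟩
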